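/- Notation. For $0<q<1$ put $(x;q)_n=\prod_{k=0}^{n-1}(1-xq^k)$, $(x;q)_\infty=\prod_{k=0}^{\infty}(1-xq^k)$, $(x_1,\dots,x_r;q)_n=\prod_i(x_i;q)_n$ for $n\in\mathbb N_0\cup\{\infty\}$, and $\Omega_q=\{q^{-k}:k\in\mathbb N_0\}$; $t^{\pm}$ in a list of parameters stands for the two entries with $t$ and with $t^{-1}$. Let $${}_4\phi_3\!\left(\begin{matrix}a_1,\dots,a_4\\ b_1,b_2,b_3\end{matrix};q,z\right)=\sum_{k\ge0}\frac{(a_1,\dots,a_4;q)_k}{(q,b_1,b_2,b_3;q)_k}z^k .$$ **Theorem 7.1.** Let $0<q<1$ and $t,a,b,c,d\in\mathbb C\setminus\{0\}$ with $ab=cd$ and $\frac{qt}{ac},\frac{q}{act}\notin\Omega_q$. For $l,m\in\mathbb N_0$ put $$R_{l,m}(t)={}_4\phi_3\!\left(\begin{matrix}q^{-l},\frac{q^l}{c^2},\frac{qat}{c},\frac{qbt}{c}\\ \frac{q^{1-m}at}{c},\frac{q^{m+1}t}{ac},\frac{qd}{c}\end{matrix};q,q\right),\qquad K=\frac{(\frac{q}{a^2},\frac{q}{c^2},\frac{qbt^\pm}{c};q)_\infty}{(\frac{qb}{a},\frac{qd}{c},\frac{qt^\pm}{ac};q)_\infty}.$$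 (1) Suppose $|qb|<|a|$, $\frac1{ab}\notin\Omega_q$, $\frac{qd}{c}\notin\Omega_q$ and $c^2\ne1$. Let $m,m'\in\mathbb N_0$ be such that $\frac{q^{1-m}at}{c},\frac{q^{1-m'}a}{ct}\notin\Omega_q$, $a^2\neq q^{2m}$, and $a^2\ne q^k$ for $0\le k<m$. Then $$\sum_{l=0}^\infty\frac{1-\frac{q^{2l}}{c^2}}{1-\frac1{c^2}}\,\frac{(\frac{qd}{c},\frac1{c^2};q)_l}{(q,\frac1{ab};q)_l}\Big(\frac{c}{qd}\Big)^lR_{l,m}(t)R_{l,m'}(t^{-1})=K\Big(\frac{c}{qd}\Big)^m\frac{1-\frac1{a^2}}{1-\frac{q^{2m}}{a^2}}\,\frac{(q,\frac{qb}{a},\frac{qt^\pm}{ac};q)_m}{(\frac1{a^2},\frac1{ab},\frac{ct^\pm}{a};q)_m}\,\delta_{m,m'}$$ (the right-hand side being $0$ for $m\neq m'$). (2) Suppose $|qd|<|c|$, $\frac{qb}{a}\notin\Omega_q$, $a^2\neq1$, and $\frac{q^{1-m}at}{c},\frac{q^{1-m}a}{ct}\notin\Omega_q$ for all $m\in\mathbb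 N_0$. Let $l,l'\in\mathbb N_0$ be such that $c^2\ne q^{2l}$ and $c^2\neq q^k$ for $0\le k<l$. Then $$\sum_{m=0}^\infty\frac{1-\frac{q^{2m}}{a^2}}{1-\frac1{a^2}}\,\frac{(\frac1{a^2},\frac1{ab},\frac{ct^\pm}{a};q)_m}{(q,\frac{qb}{a},\frac{qt^\pm}{ac};q)_m}\Big(\frac{qd}{c}\Big)^mR_{l,m}(t)R_{l',m}(t^{-1})=K\Big(\frac{qd}{c}\Big)^l\frac{1-\frac1{c^2}}{1-\frac{q^{2l}}{c^2}}\,\frac{(q,\frac1{cd};q)_l}{(\frac1{c^2},\frac{qd}{c};q)_l}\,\delta_{l,l'}.$$ Both series converge absolutely. -/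

import Mathlib

noncomputable section

/-- The finite `q`-shifted factorial `(a;q)_n = (1-a)(1-aq)⋯(1-aq^{n-1})`. -/
def qPoch (a q : ℂ) (n : ℕ) : ℂ :=
  ∏ k ∈ Finset.range n, (1 - a * q ^ k)

/-- The infinite `q`-shifted factorial `(a;q)_∞` (a convergent product for `|q| < 1`). -/
def qPochInf (a q : ℂ) : ℂ :=
  ∏' k : ℕ, (1 - a * q ^ k)

/-- `(a₁,…,a_r;q)_n = (a₁;q)_n ⋯ (a_r;q)_n`. -/
def qPochs (as : List ℂ) (q : ℂ) (n : ℕ) : ℂ :=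
  (as.map fun a => qPoch a q n).prod

/-- `(a₁,…,a_r;q)_∞ = (a₁;q)_∞ ⋯ (a_r;q)_∞`. -/
def qPochsInf (as : List ℂ) (q : ℂ) : ℂ :=
  (as.map fun a => qPochInf a q).prod

/-- The set `Ω_q = {q^{-k} : k ∈ ℕ₀}` of forbidden lower parameters:
for `q ≠ 0`, `x ∉ Ω_q` iff `(x;q)_n ≠ 0` for all `n`. -/
def qOmega (q : ℂ) : Set ℂ :=
  {x | ∃ k : ℕ, x = q ^ (-(k : ℤ))}

/-- The basic hypergeometric series `_rφ_s(a₁,…,a_r; b₁,…,b_s; q, z)`. -/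
def basicHyp (as bs : List ℂ) (q z : ℂ) : ℂ :=
  ∑' k : ℕ, qPochs as q k / qPochs (q :: bs) q k
    * ((-1) ^ k * q ^ (k.choose 2)) ^ (1 + (bs.length : ℤ) - (as.length : ℤ)) * z ^ k

/-- The rational balanced (for `ab = cd`) `₄φ₃`-function
`₄φ₃(q^{-l}, q^l/c², qat/c, qbt/c; q^{1-m}at/c, q^{m+1}t/(ac), qd/c; q, q)`. -/
def rationalPhi (q t a b c d : ℂ) (l m : ℕ) : ℂ :=
  basicHyp
    [q ^ (-(l : ℤ)), q ^ l / c ^ 2, q * a * t / c, q * b * t / c]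
    [q ^ (1 - (m : ℤ)) * a * t / c, q ^ (m + 1) * t / (a * c), q * d / c]
    q q

/-- The constant
`(q/a², q/c², qbt/c, qb/(ct); q)_∞ / (qb/a, qd/c, qt/(ac), q/(act); q)_∞`. -/
def bioConst (q t a b c d : ℂ) : ℂ :=
  qPochsInf [q / a ^ 2, q / c ^ 2, q * b * t / c, q * b * t⁻¹ / c] q
    / qPochsInf [q * b / a, q * d / c, q * t / (a * c), q * t⁻¹ / (a * c)] q

end

/-! The factors `(ct⁻¹/a)_m/(qt/(ac))_m` and `(ct/a)_m/(qt⁻¹/(ac))_m` of the weight in (2) turn the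
two `₄φ₃`'s into finite sums (`rationalSum`) whose terms involve `m` only through shifted factorials
of length `m` and powers `q^{km}`. Each product of a `k`-th and a `j`-th term with the remaining
weight is a very-well-poised `₆φ₅` term with parameters `X q^{-k}`, `X' q^{-j}`. Summing over `m` by
the nonterminating `₆φ₅` formula (`hasSum_sixPhiFiveTerm`) leaves, up to a constant and the
coefficients of the two sums, `(C;q)_{k+j} (y q^{k+j+1};q)_∞`, which depends on `k + j` only.
Biorthogonality thus becomes orthogonality of polynomials for a functional with these moments
(`sum_sum_balancedCoeff`), a consequence of the `q`-Saalschütz sum.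

Relation (1) follows from (2) by duality (`rationalSum_duality`): `q`-Saalschütz expands a
normalised `rationalSum` as a double sum symmetric in degree and argument, so exchanging `l` with
`m` amounts to exchanging `(a,b)` with `(c,d)`.

`HasSum` over `ℂ` is unconditional, hence absolute, convergence. -/

/-! ### Shifted factorials: nonvanishing, limits and uniform bounds. -/

theorem qPoch_zero (x q : ℂ) : qPoch x q 0 = 1 := by simp [qPoch]

theorem qPoch_succ (x q : ℂ) (n : ℕ) : qPoch x q (n + 1) = qPoch x q n * (1 - x * q ^ n) := by
  simp [qPoch, Finset.prod_range_succ]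

theorem qPoch_add (x q : ℂ) (m n : ℕ) :
    qPoch x q (m + n) = qPoch x q m * qPoch (x * q ^ m) q n := by
  simp only [qPoch, Finset.prod_range_add]
  congr 1
  exact Finset.prod_congr rfl fun k _ => by ring

theorem qPoch_succ_left (x q : ℂ) (n : ℕ) :
    qPoch x q (n + 1) = (1 - x) * qPoch (x * q) q n := by
  rw [add_comm, qPoch_add]
  simp [qPoch]

theorem one_sub_mul_pow_ne_zero {x q : ℂ} (hx : x ∉ qOmega q) (n : ℕ) :
    1 - x * q ^ n ≠ 0 := by
  intro h
  refine hx ⟨n, ?_⟩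
  rw [zpow_neg, zpow_natCast]
  exact eq_inv_of_mul_eq_one_left (sub_eq_zero.mp h).symm

theorem qPoch_ne_zero {x q : ℂ} (hx : x ∉ qOmega q) (n : ℕ) : qPoch x q n ≠ 0 :=
  Finset.prod_ne_zero_iff.mpr fun k _ => one_sub_mul_pow_ne_zero hx k

theorem mul_pow_notMem_qOmega {x q : ℂ} (hq : q ≠ 0) (hx : x ∉ qOmega q) (n : ℕ) :
    x * q ^ n ∉ qOmega q := by
  rintro ⟨k, hk⟩
  refine hx ⟨k + n, ?_⟩
  rw [zpow_neg, zpow_natCast] at hk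
  push_cast
  rw [neg_add, zpow_add₀ hq, zpow_neg, zpow_neg, zpow_natCast, zpow_natCast, ← hk]
  field_simp

theorem notMem_qOmega_of_norm_lt_one {x q : ℂ} (hq : q ≠ 0) (hq1 : ‖q‖ < 1) (hx : ‖x‖ < 1) :
    x ∉ qOmega q := by
  rintro ⟨k, rfl⟩
  rw [zpow_neg, zpow_natCast, norm_inv, norm_pow] at hx
  exact absurd hx (not_lt.mpr ((one_le_inv₀ (pow_pos (norm_pos_iff.mpr hq) k)).mpr
    (pow_le_one₀ (norm_nonneg _) hq1.le)))

theorem summable_mul_pow {q : ℂ} (hq1 : ‖q‖ < 1) (x : ℂ) : Summable fun k : ℕ => ‖-(x * q ^ k)‖ := by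
  simp only [norm_neg, norm_mul, norm_pow]
  exact (summable_geometric_of_lt_one (norm_nonneg q) hq1).mul_left _

theorem multipliable_qPoch {q : ℂ} (hq1 : ‖q‖ < 1) (x : ℂ) :
    Multipliable fun k : ℕ => 1 - x * q ^ k := by
  simpa [sub_eq_add_neg] using multipliable_one_add_of_summable (summable_mul_pow hq1 x)

theorem tendsto_qPoch {q : ℂ} (hq1 : ‖q‖ < 1) (x : ℂ) :
    Filter.Tendsto (fun n => qPoch x q n) Filter.atTop (nhds (qPochInf x q)) :=
  (multipliable_qPoch hq1 x).hasProd.tendsto_prod_nat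

theorem qPochInf_ne_zero {x q : ℂ} (hq1 : ‖q‖ < 1) (hx : x ∉ qOmega q) :
    qPochInf x q ≠ 0 := by
  have := tprod_one_add_ne_zero_of_summable (f := fun k : ℕ => -(x * q ^ k))
    (fun k => by simpa [sub_eq_add_neg] using one_sub_mul_pow_ne_zero hx k)
    (summable_mul_pow hq1 x)
  simpa [qPochInf, sub_eq_add_neg] using this

theorem qPochInf_eq_qPoch_mul {q : ℂ} (hq1 : ‖q‖ < 1) (x : ℂ) (n : ℕ) :
    qPochInf x q = qPoch x q n * qPochInf (x * q ^ n) q := by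
  refine tendsto_nhds_unique ?_ ((tendsto_qPoch hq1 (x * q ^ n)).const_mul (qPoch x q n))
  simp only [← qPoch_add]
  exact (Filter.tendsto_add_atTop_iff_nat n).mpr (tendsto_qPoch hq1 x) |>.congr
    fun k => by rw [add_comm]

theorem norm_qPoch_le {q : ℂ} (hq1 : ‖q‖ < 1) (x : ℂ) (N n : ℕ) :
    ‖qPoch (x * q ^ N) q n‖ ≤ Real.exp (‖x‖ * (1 - ‖q‖)⁻¹) := by
  have h1 : ∀ k, ‖1 - x * q ^ N * q ^ k‖ ≤ Real.exp (‖x‖ * ‖q‖ ^ k) := fun k => by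
    have h2 : ‖x * q ^ N * q ^ k‖ ≤ ‖x‖ * ‖q‖ ^ k := by
      rw [norm_mul, norm_mul, norm_pow, norm_pow]
      have := pow_le_one₀ (n := N) (norm_nonneg q) hq1.le
      gcongr
      exact mul_le_of_le_one_right (norm_nonneg x) this
    calc ‖1 - x * q ^ N * q ^ k‖ ≤ ‖(1 : ℂ)‖ + ‖x * q ^ N * q ^ k‖ := norm_sub_le _ _
      _ ≤ ‖x‖ * ‖q‖ ^ k + 1 := by rw [norm_one]; linarith
      _ ≤ _ := Real.add_one_le_exp _
  rw [qPoch, norm_prod]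
  refine (Finset.prod_le_prod (fun _ _ => norm_nonneg _) fun k _ => h1 k).trans ?_
  rw [← Real.exp_sum, ← Finset.mul_sum]
  gcongr
  rw [← tsum_geometric_of_lt_one (norm_nonneg q) hq1]
  exact (summable_geometric_of_lt_one (norm_nonneg q) hq1).sum_le_tsum _
    fun _ _ => by positivity

/-- Uniformity in the shift `N` serves the dominated convergence under `A ↦ A q^N` below. Since `(x
q^N)_n = (x)_{N+n} / (x)_N`, it reduces to the convergent sequence `1/(x)_n`. -/
theorem exists_norm_inv_qPoch_le {x q : ℂ} (hq : q ≠ 0) (hq1 : ‖q‖ < 1) (hx : x ∉ qOmega q) :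
    ∃ M : ℝ, 0 ≤ M ∧ ∀ N n : ℕ, ‖(qPoch (x * q ^ N) q n)⁻¹‖ ≤ M := by
  obtain ⟨M, hM⟩ := (Metric.isBounded_range_of_tendsto _
    ((tendsto_qPoch hq1 x).inv₀ (qPochInf_ne_zero hq1 hx))).exists_norm_le
  have hM' : ∀ n, ‖(qPoch x q n)⁻¹‖ ≤ M := fun n => hM _ ⟨n, rfl⟩
  have hM0 : 0 ≤ M := (norm_nonneg _).trans (hM' 0)
  refine ⟨Real.exp (‖x‖ * (1 - ‖q‖)⁻¹) * M, by positivity, fun N n => ?_⟩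
  have h : (qPoch (x * q ^ N) q n)⁻¹ = qPoch x q N * (qPoch x q (N + n))⁻¹ := by
    rw [qPoch_add]
    have := qPoch_ne_zero hx N
    have := qPoch_ne_zero (mul_pow_notMem_qOmega hq hx N) n
    field_simp
  rw [h, norm_mul]
  have := norm_qPoch_le hq1 x 0 N
  rw [pow_zero, mul_one] at this
  gcongr
  exact hM' _

/-! ### The nonterminating `₆φ₅` summation. -/

/-- The `n`-th term of the very-well-poised series `₆φ₅`, with the factor `1 - A` cancelled so
that it makes sense at `A = 1`. -/
noncomputable def sixPhiFiveTerm (q A B C D : ℂ) : ℕ → ℂ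
  | 0 => 1
  | n + 1 => (1 - A * q ^ (2 * (n + 1))) * qPoch (A * q) q n
      * (qPoch B q (n + 1) * qPoch C q (n + 1) * qPoch D q (n + 1))
      / (qPoch q q (n + 1) * (qPoch (A * q / B) q (n + 1) * qPoch (A * q / C) q (n + 1)
        * qPoch (A * q / D) q (n + 1)))
      * (A * q / (B * C * D)) ^ (n + 1)

theorem sixPhiFiveTerm_eq {q A B C D : ℂ} (hA : A ≠ 1) (n : ℕ) :
    sixPhiFiveTerm q A B C D n = (1 - A * q ^ (2 * n)) / (1 - A)
      * (qPoch A q n * qPoch B q n * qPoch C q n * qPoch D q n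
        / (qPoch q q n * qPoch (A * q / B) q n * qPoch (A * q / C) q n * qPoch (A * q / D) q n))
      * (A * q / (B * C * D)) ^ n := by
  have h : 1 - A ≠ 0 := sub_ne_zero.mpr hA.symm
  cases n with
  | zero => simp [sixPhiFiveTerm, qPoch_zero, h]
  | succ n =>
    rw [sixPhiFiveTerm, qPoch_succ_left A]
    field_simp

/-- Puts the terms for `A q` over the denominators `(Aq/B)_{m+1}`, `(Aq/C)_{m+1}`, `(Aq/D)_{m+1}`,
for comparison with those for `A`. -/
theorem one_sub_mul_sixPhiFiveTerm {q A B C D : ℂ} (hAB : A * q / B ∉ qOmega q)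
    (hAC : A * q / C ∉ qOmega q) (hAD : A * q / D ∉ qOmega q) (m : ℕ) :
    (1 - A * q) * sixPhiFiveTerm q (A * q) B C D m
      = (1 - A * q / B) * (1 - A * q / C) * (1 - A * q / D)
        * ((1 - A * q * q ^ (2 * m)) * qPoch (A * q) q m
          * (qPoch B q m * qPoch C q m * qPoch D q m)
          / (qPoch q q m * (qPoch (A * q / B) q (m + 1) * qPoch (A * q / C) q (m + 1)
            * qPoch (A * q / D) q (m + 1))) * (A * q / (B * C * D) * q) ^ m) := by
  have key : ∀ E, A * q / E ∉ qOmega q → 1 - A * q / E ≠ 0 := fun E hE => by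
    simpa using one_sub_mul_pow_ne_zero hE 0
  have hb := key B hAB
  have hc := key C hAC
  have hd := key D hAD
  have hE : ∀ E, A * q * q / E = A * q / E * q := fun E => by ring
  cases m with
  | zero =>
    simp only [sixPhiFiveTerm, qPoch_succ, qPoch_zero, pow_zero, mul_one, one_mul, mul_zero]
    field_simp
  | succ n =>
    rw [sixPhiFiveTerm, hE B, hE C, hE D, hE (B * C * D), qPoch_succ_left (A * q),
      qPoch_succ_left (A * q / B) q (n + 1), qPoch_succ_left (A * q / C) q (n + 1),
      qPoch_succ_left (A * q / D) q (n + 1)]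
    generalize A * q / B = b at *
    generalize A * q / C = c at *
    generalize A * q / D = d at *
    generalize A * q / (B * C * D) = z
    generalize qPoch (b * q) q (n + 1) = b'
    generalize qPoch (c * q) q (n + 1) = c'
    generalize qPoch (d * q) q (n + 1) = d'
    generalize (z * q) ^ (n + 1) = w
    clear hE key
    rw [show (1 - b) * b' * ((1 - c) * c') * ((1 - d) * d')
      = (1 - b) * (1 - c) * (1 - d) * (b' * c' * d') by ring]
    have h3 : (1 - b) * (1 - c) * (1 - d) ≠ 0 := mul_ne_zero (mul_ne_zero hb hc) hd
    generalize (1 - b) * (1 - c) * (1 - d) = e at *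
    rw [show qPoch q q (n + 1) * (e * (b' * c' * d')) = e * (qPoch q q (n + 1) * (b' * c' * d')) by
      ring, div_mul_eq_mul_div, div_mul_eq_mul_div, mul_div_assoc', mul_div_assoc',
      mul_div_mul_left _ _ h3]
    ring

/-- The telescoping identity with common factors removed and `x = q^m`: on the right, the closed
form of the partial sum through `m` minus that through `m - 1`. -/
theorem sixPhiFive_certificate {q A B C D x : ℂ} (hB : B ≠ 0) (hC : C ≠ 0) (hD : D ≠ 0) :
    (1 - A * q / (B * C * D)) * (1 - A * x ^ 2)
        * ((1 - A * q / B * x) * (1 - A * q / C * x) * (1 - A * q / D * x))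
      - (1 - A * q / (B * C)) * (1 - A * q / (B * D)) * (1 - A * q / (C * D))
        * ((1 - A * q * x ^ 2) * (1 - A * x) * x)
      = (A * (A * q / (B * C * D)) * (q * x) - 1) * (A * q / (B * C * D))
          * ((1 - A * x) * (1 - B * x) * (1 - C * x) * (1 - D * x))
        - (A * (A * q / (B * C * D)) * x - 1)
          * ((1 - x) * ((1 - A * q / B * x) * (1 - A * q / C * x) * (1 - A * q / D * x))) := by
  field_simp
  ring

/-- The same identity at `x = 1` with the factor `1 - A` cancelled, as the convention for
`sixPhiFiveTerm` at `0` demands. -/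
theorem sixPhiFive_certificate_zero {q A B C D : ℂ} (hB : B ≠ 0) (hC : C ≠ 0) (hD : D ≠ 0) :
    (1 - A * q / (B * C * D)) * ((1 - A * q / B) * (1 - A * q / C) * (1 - A * q / D))
      - (1 - A * q / (B * C)) * (1 - A * q / (B * D)) * (1 - A * q / (C * D)) * (1 - A * q)
      = (A * (A * q / (B * C * D)) * q - 1) * (A * q / (B * C * D))
          * ((1 - B) * (1 - C) * (1 - D)) := by
  field_simp
  ring

theorem sum_sixPhiFiveTerm_telescope {q A B C D : ℂ} (hq : q ≠ 0) (hq1 : ‖q‖ < 1)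
    (hB : B ≠ 0) (hC : C ≠ 0) (hD : D ≠ 0) (hAB : A * q / B ∉ qOmega q)
    (hAC : A * q / C ∉ qOmega q) (hAD : A * q / D ∉ qOmega q) (n : ℕ) :
    ∑ m ∈ Finset.range (n + 1),
      ((1 - A * q / B) * (1 - A * q / C) * (1 - A * q / D) * (1 - A * q / (B * C * D))
          * sixPhiFiveTerm q A B C D m
        - (1 - A * q / (B * C)) * (1 - A * q / (B * D)) * (1 - A * q / (C * D))
          * ((1 - A * q) * sixPhiFiveTerm q (A * q) B C D m))
      = (1 - A * q / B) * (1 - A * q / C) * (1 - A * q / D)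
        * ((A * (A * q / (B * C * D)) * q ^ (n + 1) - 1) * qPoch (A * q) q n
          * (qPoch B q (n + 1) * qPoch C q (n + 1) * qPoch D q (n + 1))
          / (qPoch q q n * (qPoch (A * q / B) q (n + 1) * qPoch (A * q / C) q (n + 1)
            * qPoch (A * q / D) q (n + 1))) * (A * q / (B * C * D)) ^ (n + 1)) := by
  have hqq := notMem_qOmega_of_norm_lt_one hq hq1 hq1
  have hb := one_sub_mul_pow_ne_zero hAB
  have hc := one_sub_mul_pow_ne_zero hAC
  have hd := one_sub_mul_pow_ne_zero hAD
  induction n with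
  | zero =>
    have key := sixPhiFive_certificate_zero (q := q) (A := A) hB hC hD
    replace hb := hb 0
    replace hc := hc 0
    replace hd := hd 0
    simp only [zero_add, Finset.sum_range_one, one_sub_mul_sixPhiFiveTerm hAB hAC hAD]
    simp only [pow_zero, mul_one] at hb hc hd
    simp only [sixPhiFiveTerm, qPoch_succ, qPoch_zero, pow_zero,
      mul_one, one_mul, pow_one, mul_zero] at *
    generalize A * q / B = b at *
    generalize A * q / C = c at *
    generalize A * q / D = d at *
    generalize A * q / (B * C * D) = z at *
    generalize A * q / (B * C) = e1 at *
    generalize A * q / (B * D) = e2 at *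
    generalize A * q / (C * D) = e3 at *
    field_simp
    linear_combination key
  | succ n ih =>
    rw [Finset.sum_range_succ, ih, one_sub_mul_sixPhiFiveTerm hAB hAC hAD, sixPhiFiveTerm]
    have key := sixPhiFive_certificate (q := q) (A := A) (x := q ^ (n + 1)) hB hC hD
    have pb := qPoch_ne_zero hAB (n + 1)
    have pc := qPoch_ne_zero hAC (n + 1)
    have pd := qPoch_ne_zero hAD (n + 1)
    have pq := qPoch_ne_zero hqq n
    have qn := one_sub_mul_pow_ne_zero hqq n
    replace hb := hb (n + 1)
    replace hc := hc (n + 1)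
    replace hd := hd (n + 1)
    rw [qPoch_succ (A * q / B) _ (n + 1), qPoch_succ (A * q / C) _ (n + 1),
      qPoch_succ (A * q / D) _ (n + 1), qPoch_succ B _ (n + 1), qPoch_succ C _ (n + 1),
      qPoch_succ D _ (n + 1), qPoch_succ (A * q) _ n, qPoch_succ q _ n, show q * q ^ n = q ^ (n + 1) by ring,
      show A * q * q ^ n = A * q ^ (n + 1) by ring, show q ^ (n + 1 + 1) = q * q ^ (n + 1) by ring,
      show q ^ (2 * (n + 1)) = (q ^ (n + 1)) ^ 2 by ring, mul_pow _ q, pow_succ _ (n + 1)]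
    rw [show q * q ^ n = q ^ (n + 1) by ring] at qn
    generalize qPoch (A * q / B) q (n + 1) = b' at *
    generalize qPoch (A * q / C) q (n + 1) = c' at *
    generalize qPoch (A * q / D) q (n + 1) = d' at *
    generalize qPoch q q n = q' at *
    generalize qPoch (A * q) q n = a' at *
    generalize qPoch B q (n + 1) = B' at *
    generalize qPoch C q (n + 1) = C' at *
    generalize qPoch D q (n + 1) = D' at *
    generalize A * q / B = b at *
    generalize A * q / C = c at *
    generalize A * q / D = d at *
    generalize A * q / (B * C * D) = z at *
    generalize A * q / (B * C) = e1 at *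
    generalize A * q / (B * D) = e2 at *
    generalize A * q / (C * D) = e3 at *
    generalize q ^ (n + 1) = x at *
    generalize z ^ (n + 1) = Z at *
    clear ih
    -- The certificate is multiplied by the factor common to all terms before its linear factors
    -- become opaque; afterwards only denominators remain to be cleared.
    have e : ∀ u v w : ℂ, u - v = w → u * ((1 - b) * (1 - c) * (1 - d) * (a' * B' * C' * D' * Z)
        / (q' * (1 - x) * (b' * c' * d') * ((1 - b * x) * (1 - c * x) * (1 - d * x))))
      - v * ((1 - b) * (1 - c) * (1 - d) * (a' * B' * C' * D' * Z)
        / (q' * (1 - x) * (b' * c' * d') * ((1 - b * x) * (1 - c * x) * (1 - d * x))))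
      = w * ((1 - b) * (1 - c) * (1 - d) * (a' * B' * C' * D' * Z)
        / (q' * (1 - x) * (b' * c' * d') * ((1 - b * x) * (1 - c * x) * (1 - d * x)))) := by
      rintro u v w rfl
      ring
    have key' := e _ _ _ key
    clear e key
    generalize (1 - b) * (1 - c) * (1 - d) = f at *
    rw [← sub_eq_zero] at key'
    generalize 1 - b * x = b₁ at *
    generalize 1 - c * x = c₁ at *
    generalize 1 - d * x = d₁ at *
    generalize 1 - x = x₁ at *
    generalize 1 - A * x = a₁ at *
    generalize 1 - B * x = B₁ at *
    generalize 1 - C * x = C₁ at *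
    generalize 1 - D * x = D₁ at *
    generalize (1 - e1) * (1 - e2) * (1 - e3) = e at *
    generalize 1 - A * q * x ^ 2 = a₂ at *
    generalize 1 - A * x ^ 2 = a₃ at *
    rw [← sub_eq_zero]
    refine Eq.trans ?_ key'
    field_simp
    ring

theorem exists_norm_sixPhiFiveTerm_le {q A B C D : ℂ} (hq : q ≠ 0) (hq1 : ‖q‖ < 1)
    (hAB : A * q / B ∉ qOmega q) (hAC : A * q / C ∉ qOmega q) (hAD : A * q / D ∉ qOmega q) :
    ∃ M : ℝ, 0 ≤ M ∧ ∀ N n : ℕ, ‖sixPhiFiveTerm q (A * q ^ N) B C D n‖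
      ≤ M * (‖A * q / (B * C * D)‖ * ‖q‖ ^ N) ^ n := by
  obtain ⟨Iq, hIq, hq'⟩ := exists_norm_inv_qPoch_le hq hq1 (notMem_qOmega_of_norm_lt_one hq hq1 hq1)
  obtain ⟨IB, hIB, hB'⟩ := exists_norm_inv_qPoch_le hq hq1 hAB
  obtain ⟨IC, hIC, hC'⟩ := exists_norm_inv_qPoch_le hq hq1 hAC
  obtain ⟨ID, hID, hD'⟩ := exists_norm_inv_qPoch_le hq hq1 hAD
  have hP : ∀ x n, ‖qPoch x q n‖ ≤ Real.exp (‖x‖ * (1 - ‖q‖)⁻¹) := fun x n => by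
    simpa using norm_qPoch_le hq1 x 0 n
  set e : ℂ → ℝ := fun x => Real.exp (‖x‖ * (1 - ‖q‖)⁻¹) with he
  have he0 : ∀ x, 0 ≤ e x := fun x => (Real.exp_pos _).le
  set M := (1 + ‖A‖) * e (A * q) * (e B * e C * e D) * (Iq * (IB * IC * ID)) with hM
  have hM0 : 0 ≤ M := by
    have := he0 (A * q); have := he0 B; have := he0 C; have := he0 D
    positivity
  refine ⟨1 + M, by positivity, fun N n => ?_⟩
  cases n with
  | zero => simpa [sixPhiFiveTerm] using hM0
  | succ n =>
    have hs : ∀ E, A * q ^ N * q / E = A * q / E * q ^ N := fun E => by ring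
    have hA : ‖1 - A * q ^ N * q ^ (2 * (n + 1))‖ ≤ 1 + ‖A‖ := by
      refine (norm_sub_le _ _).trans ?_
      rw [norm_one, norm_mul, norm_mul, norm_pow, norm_pow]
      have h1 := pow_le_one₀ (n := N) (norm_nonneg q) hq1.le
      have h2 := pow_le_one₀ (n := 2 * (n + 1)) (norm_nonneg q) hq1.le
      have := mul_le_mul h1 h2 (by positivity) zero_le_one
      rw [mul_assoc]
      nlinarith [norm_nonneg A]
    have hAq : ‖qPoch (A * q ^ N * q) q n‖ ≤ e (A * q) := by
      rw [show A * q ^ N * q = A * q * q ^ N by ring]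
      exact norm_qPoch_le hq1 _ _ _
    have hqn : ‖(qPoch q q (n + 1))⁻¹‖ ≤ Iq := by simpa using hq' 0 (n + 1)
    have hz : ‖A * q / (B * C * D) * q ^ N‖ = ‖A * q / (B * C * D)‖ * ‖q‖ ^ N := by
      rw [norm_mul, norm_pow]
    rw [sixPhiFiveTerm, hs B, hs C, hs D, hs (B * C * D), norm_mul, norm_pow, hz, div_eq_mul_inv,
      norm_mul, mul_inv, mul_inv, mul_inv, norm_mul, norm_mul, norm_mul, norm_mul, norm_mul,
      norm_mul, norm_mul]
    refine mul_le_mul_of_nonneg_right (le_trans ?_ (le_add_of_nonneg_left zero_le_one))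
      (by positivity)
    rw [hM]
    gcongr
    · exact hP _ _
    · exact hP _ _
    · exact hP _ _
    · exact hB' _ _
    · exact hC' _ _
    · exact hD' _ _

theorem summable_sixPhiFiveTerm {q A B C D : ℂ} (hq : q ≠ 0) (hq1 : ‖q‖ < 1)
    (hAB : A * q / B ∉ qOmega q) (hAC : A * q / C ∉ qOmega q) (hAD : A * q / D ∉ qOmega q)
    (hz : ‖A * q / (B * C * D)‖ < 1) : Summable (sixPhiFiveTerm q A B C D) := by
  obtain ⟨M, -, hM⟩ := exists_norm_sixPhiFiveTerm_le hq hq1 hAB hAC hAD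
  refine Summable.of_norm_bounded
    ((summable_geometric_of_lt_one (norm_nonneg _) hz).mul_left M) fun n => ?_
  simpa using hM 0 n

/-- The telescoped partial sums carry the factor `(Aq/(BCD))^{n+1}` and tend to `0`. The relation is
iterated along `A q^N`, which may equal `1`; hence the cancelled form of the terms. -/
theorem tsum_sixPhiFiveTerm_shift {q A B C D : ℂ} (hq : q ≠ 0) (hq1 : ‖q‖ < 1)
    (hB : B ≠ 0) (hC : C ≠ 0) (hD : D ≠ 0) (hAB : A * q / B ∉ qOmega q)
    (hAC : A * q / C ∉ qOmega q) (hAD : A * q / D ∉ qOmega q)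
    (hz : ‖A * q / (B * C * D)‖ < 1) :
    (1 - A * q / B) * (1 - A * q / C) * (1 - A * q / D) * (1 - A * q / (B * C * D))
        * ∑' n, sixPhiFiveTerm q A B C D n
      = (1 - A * q / (B * C)) * (1 - A * q / (B * D)) * (1 - A * q / (C * D))
          * ((1 - A * q) * ∑' n, sixPhiFiveTerm q (A * q) B C D n) := by
  have hs : ∀ E, A * q * q / E = A * q / E * q ^ 1 := fun E => by ring
  have h1 := summable_sixPhiFiveTerm hq hq1 hAB hAC hAD hz
  have h2 : Summable (sixPhiFiveTerm q (A * q) B C D) := by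
    refine summable_sixPhiFiveTerm hq hq1 ?_ ?_ ?_ ?_
    · rw [hs]; exact mul_pow_notMem_qOmega hq hAB 1
    · rw [hs]; exact mul_pow_notMem_qOmega hq hAC 1
    · rw [hs]; exact mul_pow_notMem_qOmega hq hAD 1
    · rw [hs, pow_one, norm_mul]
      nlinarith [norm_nonneg q, norm_nonneg (A * q / (B * C * D))]
  have h3 := ((h1.hasSum.mul_left ((1 - A * q / B) * (1 - A * q / C) * (1 - A * q / D)
    * (1 - A * q / (B * C * D)))).sub ((h2.hasSum.mul_left (1 - A * q)).mul_left
      ((1 - A * q / (B * C)) * (1 - A * q / (B * D)) * (1 - A * q / (C * D))))).tendsto_sum_nat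
  rw [← sub_eq_zero]
  refine tendsto_nhds_unique ((Filter.tendsto_add_atTop_iff_nat 1).mpr h3) ?_
  simp only [sum_sixPhiFiveTerm_telescope hq hq1 hB hC hD hAB hAC hAD]
  have hp := fun x => tendsto_qPoch hq1 x
  have hp' := fun x => (Filter.tendsto_add_atTop_iff_nat 1).mpr (hp x)
  have hqn := (Filter.tendsto_add_atTop_iff_nat 1).mpr (tendsto_pow_atTop_nhds_zero_of_norm_lt_one hq1)
  have hzn := (Filter.tendsto_add_atTop_iff_nat 1).mpr (tendsto_pow_atTop_nhds_zero_of_norm_lt_one hz)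
  have := ((((((hqn.const_mul (A * (A * q / (B * C * D)))).sub_const 1).mul (hp (A * q))).mul
    (((hp' B).mul (hp' C)).mul (hp' D))).div ((hp q).mul
      (((hp' (A * q / B)).mul (hp' (A * q / C))).mul (hp' (A * q / D)))) (by
        refine mul_ne_zero (qPochInf_ne_zero hq1 (notMem_qOmega_of_norm_lt_one hq hq1 hq1))
          (mul_ne_zero (mul_ne_zero ?_ ?_) ?_)
        exacts [qPochInf_ne_zero hq1 hAB, qPochInf_ne_zero hq1 hAC,
          qPochInf_ne_zero hq1 hAD])).mul hzn).const_mul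
      ((1 - A * q / B) * (1 - A * q / C) * (1 - A * q / D))
  simpa only [mul_zero, Pi.div_apply] using this

/-- The argument of the series is of order `q^N`, so only the zeroth term survives. -/
theorem tendsto_tsum_sixPhiFiveTerm {q A B C D : ℂ} (hq : q ≠ 0) (hq1 : ‖q‖ < 1)
    (hAB : A * q / B ∉ qOmega q) (hAC : A * q / C ∉ qOmega q) (hAD : A * q / D ∉ qOmega q)
    (hz : ‖A * q / (B * C * D)‖ < 1) :
    Filter.Tendsto (fun N : ℕ => ∑' n, sixPhiFiveTerm q (A * q ^ N) B C D n) Filter.atTop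
      (nhds 1) := by
  obtain ⟨M, hM0, hM⟩ := exists_norm_sixPhiFiveTerm_le hq hq1 hAB hAC hAD
  rw [show (1 : ℂ) = ∑' n : ℕ, if n = 0 then 1 else 0 by rw [tsum_ite_eq]]
  refine tendsto_tsum_of_dominated_convergence
    ((summable_geometric_of_lt_one (norm_nonneg _) hz).mul_left M) ?_ ?_
  · intro n
    cases n with
    | zero => simp [sixPhiFiveTerm]
    | succ n =>
      simp only [Nat.succ_ne_zero, if_false]
      refine squeeze_zero_norm (fun N => hM N (n + 1)) ?_
      have := (((tendsto_pow_atTop_nhds_zero_of_lt_one (norm_nonneg q) hq1).const_mul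
        ‖A * q / (B * C * D)‖).pow (n + 1)).const_mul M
      simpa using this
  · refine Filter.Eventually.of_forall fun N n => (hM N n).trans ?_
    gcongr
    exact mul_le_of_le_one_right (norm_nonneg _) (pow_le_one₀ (norm_nonneg _) hq1.le)

/-- The nonterminating very-well-poised `₆φ₅` summation. -/
theorem hasSum_sixPhiFiveTerm {q A B C D : ℂ} (hq : q ≠ 0) (hq1 : ‖q‖ < 1)
    (hB : B ≠ 0) (hC : C ≠ 0) (hD : D ≠ 0) (hAB : A * q / B ∉ qOmega q)
    (hAC : A * q / C ∉ qOmega q) (hAD : A * q / D ∉ qOmega q)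
    (hz : ‖A * q / (B * C * D)‖ < 1) :
    HasSum (sixPhiFiveTerm q A B C D)
      (qPochInf (A * q) q * qPochInf (A * q / (B * C)) q * qPochInf (A * q / (B * D)) q
          * qPochInf (A * q / (C * D)) q
        / (qPochInf (A * q / B) q * qPochInf (A * q / C) q * qPochInf (A * q / D) q
          * qPochInf (A * q / (B * C * D)) q)) := by
  -- The shift relation iterated `N` times; letting `N → ∞` gives the infinite products.
  have hfin : ∀ N : ℕ, qPoch (A * q / B) q N * qPoch (A * q / C) q N * qPoch (A * q / D) q N
        * qPoch (A * q / (B * C * D)) q N * ∑' n, sixPhiFiveTerm q A B C D n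
      = qPoch (A * q) q N * qPoch (A * q / (B * C)) q N * qPoch (A * q / (B * D)) q N
        * qPoch (A * q / (C * D)) q N * ∑' n, sixPhiFiveTerm q (A * q ^ N) B C D n := by
    intro N
    induction N with
    | zero => simp [qPoch_zero]
    | succ N ih =>
      have hs : ∀ E, A * q ^ N * q / E = A * q / E * q ^ N := fun E => by ring
      have h := tsum_sixPhiFiveTerm_shift (A := A * q ^ N) hq hq1 hB hC hD
        (by rw [hs]; exact mul_pow_notMem_qOmega hq hAB N)
        (by rw [hs]; exact mul_pow_notMem_qOmega hq hAC N)
        (by rw [hs]; exact mul_pow_notMem_qOmega hq hAD N)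
        (by
          rw [hs, norm_mul, norm_pow]
          exact (mul_le_of_le_one_right (norm_nonneg _)
            (pow_le_one₀ (norm_nonneg _) hq1.le)).trans_lt hz)
      simp only [hs] at h
      rw [show A * q ^ N * q = A * q ^ (N + 1) by ring] at h
      simp only [qPoch_succ]
      rw [show A * q * q ^ N = A * q ^ (N + 1) by ring]
      linear_combination (1 - A * q / B * q ^ N) * (1 - A * q / C * q ^ N)
        * (1 - A * q / D * q ^ N) * (1 - A * q / (B * C * D) * q ^ N) * ih
        + qPoch (A * q) q N * qPoch (A * q / (B * C)) q N * qPoch (A * q / (B * D)) q N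
        * qPoch (A * q / (C * D)) q N * h
  have hp := fun x => tendsto_qPoch hq1 x
  have hlim := tendsto_nhds_unique
    (((((hp (A * q / B)).mul (hp (A * q / C))).mul (hp (A * q / D))).mul
      (hp (A * q / (B * C * D)))).mul_const (∑' n, sixPhiFiveTerm q A B C D n))
    ((((((hp (A * q)).mul (hp (A * q / (B * C)))).mul (hp (A * q / (B * D)))).mul
      (hp (A * q / (C * D)))).mul
      (tendsto_tsum_sixPhiFiveTerm hq hq1 hAB hAC hAD hz)).congr fun N => (hfin N).symm)
  have hne := mul_ne_zero (mul_ne_zero (mul_ne_zero (qPochInf_ne_zero hq1 hAB)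
    (qPochInf_ne_zero hq1 hAC)) (qPochInf_ne_zero hq1 hAD))
    (qPochInf_ne_zero hq1 (notMem_qOmega_of_norm_lt_one hq hq1 hz))
  have hsum := (summable_sixPhiFiveTerm hq hq1 hAB hAC hAD hz).hasSum
  rwa [eq_div_of_mul_eq hne ((mul_comm _ _).trans (hlim.trans (mul_one _)))] at hsum

/-! ### The `q`-Saalschütz summation. -/

/-- The terminating balanced `₃φ₂` sum `∑ (q⁻ⁿ, qⁿy, B)_j / (q, C)_j qʲ (Eqʲ)_{n-j}` in a form
without poles in `E`, partial sums of its recurrence in `n`. -/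
theorem sum_saalschutz_telescope {q p y B C E : ℂ} (hq : q ≠ 0) (hq1 : ‖q‖ < 1) (hC0 : C ≠ 0)
    (hC : C ∉ qOmega q) (hE : C * E = q * y * B) {n : ℕ} (hp : p * q ^ n = 1) {J r : ℕ}
    (hJ : J + r = n) :
    ∑ j ∈ Finset.range (J + 1),
      ((1 - C * q ^ n) * (qPoch (p / q) q j * qPoch (q ^ (n + 1) * y) q j * qPoch B q j
          / (qPoch q q j * qPoch C q j) * q ^ j * qPoch (E * q ^ j) q (n + 1 - j))
        - (B - C * q ^ n) * (1 - q * y / C * q ^ n)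
          * (qPoch p q j * qPoch (q ^ n * y) q j * qPoch B q j
          / (qPoch q q j * qPoch C q j) * q ^ j * qPoch (E * q ^ j) q (n - j)))
      = (1 - q ^ (2 * n + 1) * y) * (qPoch p q J * qPoch (q ^ (n + 1) * y) q J * qPoch B q (J + 1)
          / (qPoch q q J * qPoch C q J) * qPoch (E * q ^ J) q r) := by
  have hqq := notMem_qOmega_of_norm_lt_one hq hq1 hq1
  induction J generalizing r with
  | zero =>
    obtain rfl : r = n := by omega
    obtain rfl : E = q * y * B / C := by field_simp; linear_combination hE
    simp only [zero_add, Finset.sum_range_one, qPoch_zero, pow_zero, mul_one, Nat.sub_zero,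
      qPoch_succ, div_one, one_mul]
    obtain rfl : p = (q ^ r)⁻¹ := eq_inv_of_mul_eq_one_left hp
    have hqr : q ^ r ≠ 0 := pow_ne_zero _ hq
    rw [show q ^ (2 * r + 1) = (q ^ r) ^ 2 * q by ring]
    field_simp
    ring
  | succ J ih =>
    obtain rfl : n = J + 1 + r := hJ.symm
    rw [Finset.sum_range_succ, ih (r := r + 1) (by ring)]
    have hqr : q ^ r ≠ 0 := pow_ne_zero _ hq
    have hqJ : q ^ J ≠ 0 := pow_ne_zero _ hq
    obtain rfl : E = q * y * B / C := by field_simp; linear_combination hE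
    obtain rfl : p = (q ^ (J + 1 + r))⁻¹ := eq_inv_of_mul_eq_one_left hp
    have e1 : qPoch ((q ^ (J + 1 + r))⁻¹ / q) q (J + 1)
        = (1 - (q ^ (J + 1 + r))⁻¹ / q) * qPoch (q ^ (J + 1 + r))⁻¹ q J := by
      rw [qPoch_succ_left, div_mul_cancel₀ _ hq]
    have e2 : qPoch (q ^ (J + 1 + r) * y) q (J + 1)
        = (1 - q ^ (J + 1 + r) * y) * qPoch (q ^ (J + 1 + r + 1) * y) q J := by
      rw [qPoch_succ_left]; ring_nf
    have e3 : qPoch (q * y * B / C * q ^ J) q (r + 1)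
        = (1 - q * y * B / C * q ^ J) * qPoch (q * y * B / C * q ^ (J + 1)) q r := by
      rw [qPoch_succ_left]; ring_nf
    rw [show J + 1 + r + 1 - (J + 1) = r + 1 by omega, show J + 1 + r - (J + 1) = r by omega,
      e1, e2, e3, qPoch_succ (q * y * B / C * q ^ (J + 1)), qPoch_succ (q ^ (J + 1 + r + 1) * y) q J,
      qPoch_succ (q ^ (J + 1 + r))⁻¹ q J, qPoch_succ q q J, qPoch_succ C q J, qPoch_succ B q (J + 1)]
    have h1 := qPoch_ne_zero hqq J
    have h2 := qPoch_ne_zero hC J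
    have h3 := one_sub_mul_pow_ne_zero hqq J
    have h4 := one_sub_mul_pow_ne_zero hC J
    generalize qPoch q q J = Q at *
    generalize qPoch C q J = C' at *
    generalize qPoch B q (J + 1) = B' at *
    generalize qPoch (q ^ (J + 1 + r))⁻¹ q J = P at *
    generalize qPoch (q ^ (J + 1 + r + 1) * y) q J = Y at *
    generalize qPoch (q * y * B / C * q ^ (J + 1)) q r = E' at *
    simp only [show q ^ (J + 1 + r + 1) = q ^ J * q ^ r * q ^ 2 by ring,
      show q ^ (J + 1 + r) = q ^ J * q ^ r * q by ring, show q ^ (J + 1) = q ^ J * q by ring,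
      show q ^ (2 * (J + 1 + r) + 1) = (q ^ J * q ^ r) ^ 2 * q ^ 3 by ring]
    clear ih e1 e2 e3 hp hE
    generalize q ^ J = x at *
    generalize q ^ r = R at *
    generalize hu : 1 - q * x = u at *
    generalize hv : 1 - C * x = v at *
    field_simp
    subst hu hv
    ring

theorem qPoch_inv_pow_eq_zero {q : ℂ} (hq : q ≠ 0) {k n : ℕ} (h : k < n) :
    qPoch (q ^ k)⁻¹ q n = 0 :=
  Finset.prod_eq_zero (Finset.mem_range.mpr h)
    (by rw [inv_mul_cancel₀ (pow_ne_zero _ hq), sub_self])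

/-- Squaring avoids the sign and the exponent `n(n+1)/2`; the norm in `sum_sum_balancedCoeff`
contains `(q^{-l})_l` exactly twice. -/
theorem qPoch_inv_pow_sq {q : ℂ} (hq : q ≠ 0) (n : ℕ) :
    qPoch (q ^ n)⁻¹ q n ^ 2 * q ^ (n * (n + 1)) = qPoch q q n ^ 2 := by
  induction n with
  | zero => simp [qPoch_zero]
  | succ n ih =>
    have hx : q ^ n ≠ 0 := pow_ne_zero _ hq
    rw [qPoch_succ_left, show (q ^ (n + 1))⁻¹ * q = (q ^ n)⁻¹ by rw [pow_succ]; field_simp,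
      qPoch_succ, mul_pow (qPoch q q n), ← ih,
      show q ^ ((n + 1) * (n + 1 + 1)) = q ^ (n * (n + 1)) * (q ^ n * q) ^ 2 by ring, pow_succ q n]
    field_simp
    ring

/-- The coefficient `(q⁻ⁿ, qⁿy; q)_k qᵏ / (q; q)_k` of the polynomials
`ᵣ₊₂φᵣ₊₁(q⁻ⁿ, qⁿy, …; …; q, q)`. -/
noncomputable def balancedCoeff (q y : ℂ) (n k : ℕ) : ℂ :=
  qPoch (q ^ n)⁻¹ q k * qPoch (q ^ n * y) q k / qPoch q q k * q ^ k

/-- The `q`-Saalschütz sum, cleared of its poles in the lower parameter `E`. -/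
theorem saalschutz_mul_qPoch {q y B C E : ℂ} (hq : q ≠ 0) (hq1 : ‖q‖ < 1) (hB : B ≠ 0)
    (hC0 : C ≠ 0) (hC : C ∉ qOmega q) (hE : C * E = q * y * B) (n : ℕ) :
    ∑ j ∈ Finset.range (n + 1), balancedCoeff q y n j * (qPoch B q j / qPoch C q j)
        * qPoch (E * q ^ j) q (n - j)
      = qPoch (q * y / C) q n * qPoch (C / B) q n / qPoch C q n * B ^ n := by
  have hqq := notMem_qOmega_of_norm_lt_one hq hq1 hq1
  induction n with
  | zero => simp [balancedCoeff, qPoch_zero]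
  | succ n ih =>
    have hx : q ^ n ≠ 0 := pow_ne_zero _ hq
    have h := sum_saalschutz_telescope hq hq1 hC0 hC hE (inv_mul_cancel₀ hx) (add_zero n)
    have hp : (q ^ n)⁻¹ / q = (q ^ (n + 1))⁻¹ := by rw [pow_succ]; field_simp
    rw [Finset.sum_sub_distrib, ← Finset.mul_sum, ← Finset.mul_sum, hp, qPoch_zero, mul_one] at h
    have hterm : ∀ (N : ℕ) (e : ℕ → ℂ), ∀ j, qPoch (q ^ N)⁻¹ q j * qPoch (q ^ N * y) q j
        * qPoch B q j / (qPoch q q j * qPoch C q j) * q ^ j * e j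
        = balancedCoeff q y N j * (qPoch B q j / qPoch C q j) * e j := fun N e j => by
      rw [balancedCoeff]; ring
    simp only [hterm n (fun j => qPoch (E * q ^ j) q (n - j)),
      hterm (n + 1) (fun j => qPoch (E * q ^ j) q (n + 1 - j)), ih] at h
    have hCn := one_sub_mul_pow_ne_zero hC n
    have hqn := one_sub_mul_pow_ne_zero hqq n
    have hQ := qPoch_ne_zero hqq n
    have hC' := qPoch_ne_zero hC n
    -- The telescoped sum stops at `j = n`. The one further term of the sum of degree `n + 1` is
    -- minus the telescoped remainder, which leaves a first-order recurrence.
    have hlast : (1 - C * q ^ n) * (balancedCoeff q y (n + 1) (n + 1)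
          * (qPoch B q (n + 1) / qPoch C q (n + 1))
          * qPoch (E * q ^ (n + 1)) q (n + 1 - (n + 1)))
        = -((1 - q ^ (2 * n + 1) * y) * (qPoch (q ^ n)⁻¹ q n * qPoch (q ^ (n + 1) * y) q n
          * qPoch B q (n + 1) / (qPoch q q n * qPoch C q n))) := by
      rw [Nat.sub_self, qPoch_zero, balancedCoeff, qPoch_succ_left (q ^ (n + 1))⁻¹,
        qPoch_succ (q ^ (n + 1) * y), qPoch_succ q, qPoch_succ C,
        show (q ^ (n + 1))⁻¹ * q = (q ^ n)⁻¹ by rw [pow_succ]; field_simp,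
        show q ^ (n + 1) * y * q ^ n = q ^ (2 * n + 1) * y by ring, pow_succ q n]
      generalize qPoch (q ^ n * q * y) q n = Y
      generalize q ^ (2 * n + 1) * y = Z
      generalize qPoch (q ^ n)⁻¹ q n = P
      generalize qPoch B q (n + 1) = B'
      generalize q ^ n = x at *
      generalize hu : 1 - q * x = u at *
      generalize hv : 1 - C * x = v at *
      field_simp
      subst hu
      ring
    rw [Finset.sum_range_succ]
    refine mul_left_cancel₀ hCn ?_
    rw [mul_add, hlast]
    have hrec : (1 - C * q ^ n) * (qPoch (q * y / C) q (n + 1) * qPoch (C / B) q (n + 1)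
          / qPoch C q (n + 1) * B ^ (n + 1))
        = (B - C * q ^ n) * (1 - q * y / C * q ^ n)
          * (qPoch (q * y / C) q n * qPoch (C / B) q n / qPoch C q n * B ^ n) := by
      simp only [qPoch_succ, pow_succ]
      generalize qPoch (q * y / C) q n = Y
      generalize qPoch (C / B) q n = Z
      generalize q * y / C = w
      generalize q ^ n = x at *
      generalize hv : 1 - C * x = v at *
      field_simp
    rw [hrec]
    linear_combination h

theorem saalschutz {q y B C E : ℂ} (hq : q ≠ 0) (hq1 : ‖q‖ < 1) (hB : B ≠ 0)
    (hC0 : C ≠ 0) (hC : C ∉ qOmega q) (hE' : E ∉ qOmega q) (hE : C * E = q * y * B) (n : ℕ) :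
    ∑ j ∈ Finset.range (n + 1), balancedCoeff q y n j * (qPoch B q j / qPoch C q j)
        / qPoch E q j
      = qPoch (q * y / C) q n * qPoch (C / B) q n / (qPoch C q n * qPoch E q n) * B ^ n := by
  have h := saalschutz_mul_qPoch hq hq1 hB hC0 hC hE n
  have hEn := qPoch_ne_zero hE' n
  refine mul_right_cancel₀ hEn ?_
  have hCn := qPoch_ne_zero hC n
  rw [show qPoch (q * y / C) q n * qPoch (C / B) q n / (qPoch C q n * qPoch E q n) * B ^ n
    * qPoch E q n = qPoch (q * y / C) q n * qPoch (C / B) q n / qPoch C q n * B ^ n by field_simp,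
    ← h, Finset.sum_mul]
  refine Finset.sum_congr rfl fun j hj => ?_
  obtain ⟨r, rfl⟩ := Nat.exists_eq_add_of_le (Nat.lt_succ_iff.mp (Finset.mem_range.mp hj))
  have hEj := qPoch_ne_zero hE' j
  rw [qPoch_add E, Nat.add_sub_cancel_left]
  field_simp

/-! ### Orthogonality of polynomials from their moments. -/

/-- Saalschütz with `E = y q^{k+1}`, multiplied by `(E q^n)_∞`; the pole-free form is used because
`E` may lie in `Ω_q`. The factor `(q^{-k})_n` vanishes for `k < n`, which is the source of
orthogonality. -/
theorem sum_balancedCoeff_mul_qPochInf {q y C : ℂ} (hq : q ≠ 0) (hq1 : ‖q‖ < 1)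
    (hC0 : C ≠ 0) (hC : C ∉ qOmega q) (n k : ℕ) :
    ∑ j ∈ Finset.range (n + 1), balancedCoeff q y n j * (qPoch (C * q ^ k) q j / qPoch C q j)
        * qPochInf (q * y * q ^ (k + j)) q
      = qPoch (q * y / C) q n * qPoch (q ^ k)⁻¹ q n / qPoch C q n * (C * q ^ k) ^ n
        * qPochInf (q * y * q ^ (k + n)) q := by
  have hk : q ^ k ≠ 0 := pow_ne_zero _ hq
  have h := saalschutz_mul_qPoch (y := y) (B := C * q ^ k) (E := q * y * q ^ k) hq hq1
    (mul_ne_zero hC0 hk) hC0 hC (by ring) n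
  rw [show C / (C * q ^ k) = (q ^ k)⁻¹ by field_simp] at h
  rw [← h, Finset.sum_mul]
  refine Finset.sum_congr rfl fun j hj => ?_
  obtain ⟨r, rfl⟩ := Nat.exists_eq_add_of_le (Nat.lt_succ_iff.mp (Finset.mem_range.mp hj))
  rw [Nat.add_sub_cancel_left, qPochInf_eq_qPoch_mul hq1 (q * y * q ^ (k + j)) r, pow_add q k j,
    show q * y * (q ^ k * q ^ j) * q ^ r = q * y * q ^ (k + (j + r)) by ring,
    show q * y * (q ^ k * q ^ j) = q * y * q ^ k * q ^ j by ring]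
  ring

/-- The orthogonality of the polynomials `∑ balancedCoeff q y n k x^k / (C;q)_k` under the
functional with moments `(C;q)_k (y q^{k+1};q)_∞`. -/
theorem sum_sum_balancedCoeff {q y C : ℂ} (hq : q ≠ 0) (hq1 : ‖q‖ < 1)
    (hC0 : C ≠ 0) (hC : C ∉ qOmega q) (l l' : ℕ) :
    ∑ k ∈ Finset.range (l + 1), ∑ j ∈ Finset.range (l' + 1),
      balancedCoeff q y l k / qPoch C q k * (balancedCoeff q y l' j / qPoch C q j)
        * (qPoch C q (k + j) * qPochInf (q * y * q ^ (k + j)) q)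
      = if l = l' then qPoch q q l * qPoch (q ^ l * y) q l * qPoch (q * y / C) q l / qPoch C q l
          * C ^ l * qPochInf (q * y * q ^ (l + l)) q else 0 := by
  wlog hll : l ≤ l' generalizing l l'
  · have h := this l' l (by omega)
    rw [if_neg (by omega)] at h ⊢
    rw [← h, Finset.sum_comm]
    refine Finset.sum_congr rfl fun k _ => Finset.sum_congr rfl fun j _ => ?_
    rw [add_comm j k]
    ring
  have hinner : ∀ k, ∑ j ∈ Finset.range (l' + 1),
      balancedCoeff q y l k / qPoch C q k * (balancedCoeff q y l' j / qPoch C q j)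
        * (qPoch C q (k + j) * qPochInf (q * y * q ^ (k + j)) q)
      = balancedCoeff q y l k * (qPoch (q * y / C) q l' * qPoch (q ^ k)⁻¹ q l' / qPoch C q l'
        * (C * q ^ k) ^ l' * qPochInf (q * y * q ^ (k + l')) q) := fun k => by
    rw [← sum_balancedCoeff_mul_qPochInf hq hq1 hC0 hC, Finset.mul_sum]
    refine Finset.sum_congr rfl fun j _ => ?_
    have := qPoch_ne_zero hC k
    rw [qPoch_add]
    field_simp
  simp only [hinner]
  -- As `k ≤ l ≤ l'`, the factor `(q^{-k})_{l'}` leaves at most `k = l`, and that only if `l = l'`.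
  rw [Finset.sum_range_succ, Finset.sum_eq_zero, zero_add]
  · rcases hll.eq_or_lt with rfl | hlt
    · rw [if_pos rfl, balancedCoeff]
      have hQ := qPoch_ne_zero (notMem_qOmega_of_norm_lt_one hq hq1 hq1) l
      have hsq := qPoch_inv_pow_sq hq l
      rw [show q ^ (l * (l + 1)) = q ^ l * (q ^ l) ^ l by ring] at hsq
      rw [mul_pow]
      field_simp
      rw [← hsq]
      ring_nf
    · rw [if_neg hlt.ne, qPoch_inv_pow_eq_zero hq hlt]
      simp
  · intro k hk
    rw [qPoch_inv_pow_eq_zero hq ((Finset.mem_range.mp hk).trans_le hll)]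
    simp

/-! ### The rational functions and their duality. -/

/-- The rational function `∑ₖ (q⁻ˡ, qˡy, u)_k / (q, C, v)_k qᵏ · (q⁻ᵏX)_m / (qᵏv)_m q^{km}`. -/
noncomputable def rationalSum (q y u v C X : ℂ) (l m : ℕ) : ℂ :=
  ∑ k ∈ Finset.range (l + 1), balancedCoeff q y l k * (qPoch u q k / (qPoch C q k * qPoch v q k))
    * (qPoch ((q ^ k)⁻¹ * X) q m / qPoch (v * q ^ k) q m * (q ^ k) ^ m)

/-- Split `(u)_{k+j} = (u)_k (u q^k)_j`, likewise for `v`, and sum over `j` by Saalschütz with `B =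
u q^k`, `E = v q^k`; the balancing condition does not depend on `k`. -/
theorem mul_rationalSum_eq_sum_sum {q y A u v C C' : ℂ} (hq : q ≠ 0) (hq1 : ‖q‖ < 1)
    (hu : u ≠ 0) (hC' : C' ≠ 0) (hv' : v ∉ qOmega q) (hCq' : C' ∉ qOmega q)
    (h : C' * v = q * A * u) (l m : ℕ) :
    qPoch (q * A / C') q m / qPoch C' q m * u ^ m * rationalSum q y u v C (C' / u) l m
      = ∑ k ∈ Finset.range (l + 1), ∑ j ∈ Finset.range (m + 1),
        balancedCoeff q y l k / qPoch C q k * (balancedCoeff q A m j / qPoch C' q j)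
          * (qPoch u q (k + j) / qPoch v q (k + j)) := by
  rw [rationalSum, Finset.mul_sum]
  refine Finset.sum_congr rfl fun k _ => ?_
  have hk : q ^ k ≠ 0 := pow_ne_zero _ hq
  have hs := saalschutz (y := A) (B := u * q ^ k) (E := v * q ^ k) hq hq1 (mul_ne_zero hu hk) hC'
    hCq' (mul_pow_notMem_qOmega hq hv' k) (by linear_combination q ^ k * h) m
  rw [show C' / (u * q ^ k) = (q ^ k)⁻¹ * (C' / u) by field_simp, mul_pow] at hs
  have e : ∑ j ∈ Finset.range (m + 1),
        balancedCoeff q y l k / qPoch C q k * (balancedCoeff q A m j / qPoch C' q j)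
          * (qPoch u q (k + j) / qPoch v q (k + j))
      = balancedCoeff q y l k / qPoch C q k * (qPoch u q k / qPoch v q k)
        * ∑ j ∈ Finset.range (m + 1), balancedCoeff q A m j
          * (qPoch (u * q ^ k) q j / qPoch C' q j) / qPoch (v * q ^ k) q j := by
    rw [Finset.mul_sum]
    refine Finset.sum_congr rfl fun j _ => ?_
    rw [qPoch_add, qPoch_add]
    simp only [div_eq_mul_inv, mul_inv]
    ring
  rw [e, hs]
  simp only [div_eq_mul_inv, mul_inv]
  ring

/-- Duality: `rationalSum` is symmetric in its degree and its argument. -/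
theorem rationalSum_duality {q y A u v C C' : ℂ} (hq : q ≠ 0) (hq1 : ‖q‖ < 1)
    (hu : u ≠ 0) (hC : C ≠ 0) (hC' : C' ≠ 0) (hv' : v ∉ qOmega q) (hCq : C ∉ qOmega q)
    (hCq' : C' ∉ qOmega q) (h : C * v = q * y * u) (h' : C' * v = q * A * u) (l m : ℕ) :
    qPoch (q * A / C') q m / qPoch C' q m * u ^ m * rationalSum q y u v C (C' / u) l m
      = qPoch (q * y / C) q l / qPoch C q l * u ^ l * rationalSum q A u v C' (C / u) m l := by
  rw [mul_rationalSum_eq_sum_sum hq hq1 hu hC' hv' hCq' h',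
    mul_rationalSum_eq_sum_sum hq hq1 hu hC hv' hCq h, Finset.sum_comm]
  refine Finset.sum_congr rfl fun k _ => Finset.sum_congr rfl fun j _ => ?_
  rw [add_comm j k]
  ring

/-! ### Biorthogonality of the rational functions. -/

theorem hasSum_rationalSum_mul {q A B X X' : ℂ} (hq : q ≠ 0) (hq1 : ‖q‖ < 1) (hA1 : A ≠ 1)
    (hA : A ≠ 0) (hB : B ≠ 0) (hX : X ≠ 0) (hX' : X' ≠ 0) (hAB : A * q / B ∉ qOmega q)
    (hAX : A * q / X ∉ qOmega q) (hAX' : A * q / X' ∉ qOmega q)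
    (hz : ‖A * q / (B * X * X')‖ < 1) (l l' : ℕ) :
    HasSum (fun m => (1 - A * q ^ (2 * m)) / (1 - A)
        * (qPoch A q m * qPoch B q m / (qPoch q q m * qPoch (A * q / B) q m))
        * (A * q / (B * X * X')) ^ m
        * rationalSum q (A / (X * X')) (A * q / (B * X)) (A * q / X) (A * q / (B * X * X')) X l m
        * rationalSum q (A / (X * X')) (A * q / (B * X')) (A * q / X') (A * q / (B * X * X'))
          X' l' m)
      (qPochInf (A * q) q * qPochInf (A * q / (B * X)) q * qPochInf (A * q / (B * X')) q
          / (qPochInf (A * q / B) q * qPochInf (A * q / X) q * qPochInf (A * q / X') q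
            * qPochInf (A * q / (B * X * X')) q)
        * if l = l' then qPoch q q l * qPoch (q ^ l * (A / (X * X'))) q l * qPoch B q l
            / qPoch (A * q / (B * X * X')) q l * (A * q / (B * X * X')) ^ l
            * qPochInf (q * (A / (X * X')) * q ^ (l + l)) q else 0) := by
  set C := A * q / (B * X * X') with hCdef
  set y := A / (X * X') with hy
  have hC0 : C ≠ 0 := by rw [hCdef]; positivity
  have hC : C ∉ qOmega q := notMem_qOmega_of_norm_lt_one hq hq1 hz
  set W : ℂ → ℕ → ℕ → ℂ := fun x l k => balancedCoeff q y l k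
    * (qPoch (A * q / (B * x)) q k / (qPoch C q k * qPoch (A * q / x) q k)) with hW
  have hqk : ∀ k : ℕ, q ^ k ≠ 0 := fun k => pow_ne_zero _ hq
  have hshift : ∀ x : ℂ, ∀ k : ℕ, A * q / ((q ^ k)⁻¹ * x) = A * q / x * q ^ k := fun x k => by
    rw [div_eq_mul_inv, mul_inv, inv_inv]; ring
  have htr : ∀ {f : ℕ → ℂ} {r s : ℂ}, HasSum f r → r = s → HasSum f s := fun h e => e ▸ h
  have hterm : ∀ k j : ℕ, HasSum (fun m => W X l k * W X' l' j
      * sixPhiFiveTerm q A B ((q ^ k)⁻¹ * X) ((q ^ j)⁻¹ * X') m)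
      (qPochInf (A * q) q * qPochInf (A * q / (B * X)) q * qPochInf (A * q / (B * X')) q
          / (qPochInf (A * q / B) q * qPochInf (A * q / X) q * qPochInf (A * q / X') q
            * qPochInf C q)
        * (balancedCoeff q y l k / qPoch C q k * (balancedCoeff q y l' j / qPoch C q j)
          * (qPoch C q (k + j) * qPochInf (q * y * q ^ (k + j)) q))) := fun k j => by
    have hz' : A * q / (B * ((q ^ k)⁻¹ * X) * ((q ^ j)⁻¹ * X')) = C * q ^ (k + j) := by
      have := hqk k; have := hqk j
      rw [hCdef, pow_add]; field_simp
    have h := (hasSum_sixPhiFiveTerm (A := A) (B := B) (C := (q ^ k)⁻¹ * X) (D := (q ^ j)⁻¹ * X')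
      hq hq1 hB (mul_ne_zero (inv_ne_zero (hqk k)) hX) (mul_ne_zero (inv_ne_zero (hqk j)) hX') hAB
      (by rw [hshift]; exact mul_pow_notMem_qOmega hq hAX k)
      (by rw [hshift]; exact mul_pow_notMem_qOmega hq hAX' j)
      (by
        rw [hz', norm_mul, norm_pow]
        exact (mul_le_of_le_one_right (norm_nonneg _)
          (pow_le_one₀ (norm_nonneg _) hq1.le)).trans_lt hz)).mul_left (W X l k * W X' l' j)
    refine htr h (Eq.symm ?_)
    -- The `k`- and `j`-dependent parts of the other infinite products cancel against `W`; what
    -- stays is `(C)_{k+j}`, from `1/(C q^{k+j})_∞`, and `(y q^{k+j+1})_∞`: the moments.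
    rw [hz', hshift, hshift,
      show A * q / (B * ((q ^ k)⁻¹ * X)) = A * q / (B * X) * q ^ k by
        have := hqk k; field_simp,
      show A * q / (B * ((q ^ j)⁻¹ * X')) = A * q / (B * X') * q ^ j by
        have := hqk j; field_simp,
      show A * q / ((q ^ k)⁻¹ * X * ((q ^ j)⁻¹ * X')) = q * y * q ^ (k + j) by
        have := hqk k; have := hqk j
        rw [hy, pow_add]; field_simp,
      qPochInf_eq_qPoch_mul hq1 (A * q / (B * X)) k, qPochInf_eq_qPoch_mul hq1 (A * q / (B * X')) j,
      qPochInf_eq_qPoch_mul hq1 (A * q / X) k, qPochInf_eq_qPoch_mul hq1 (A * q / X') j,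
      qPochInf_eq_qPoch_mul hq1 C (k + j)]
    have := qPoch_ne_zero hC (k + j)
    simp only [hW, div_eq_mul_inv, mul_inv]
    have hcc : (qPoch C q (k + j))⁻¹ * qPoch C q (k + j) = 1 := inv_mul_cancel₀ this
    refine Eq.trans ?_ ((congrArg (HMul.hMul _) hcc).trans (mul_one _))
    ring
  have hsum := hasSum_sum (s := Finset.range (l + 1)) fun k _ =>
    hasSum_sum (s := Finset.range (l' + 1)) fun j _ => hterm k j
  simp only [← Finset.mul_sum] at hsum
  rw [sum_sum_balancedCoeff hq hq1 hC0 hC, show q * y / C = B by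
    rw [hy, hCdef]; field_simp] at hsum
  have hfun : ∀ {f g : ℕ → ℂ} {r : ℂ}, HasSum g r → (∀ m, f m = g m) → HasSum f r :=
    fun h e => (funext e) ▸ h
  refine hfun hsum fun m => ?_
  rw [rationalSum, rationalSum, mul_assoc, Finset.sum_mul_sum, Finset.mul_sum]
  refine Finset.sum_congr rfl fun k _ => ?_
  rw [Finset.mul_sum]
  refine Finset.sum_congr rfl fun j _ => ?_
  have hz' : A * q / (B * ((q ^ k)⁻¹ * X) * ((q ^ j)⁻¹ * X')) = C * (q ^ k * q ^ j) := by
    have := hqk k; have := hqk j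
    rw [hCdef]; field_simp
  rw [sixPhiFiveTerm_eq hA1, hz', hshift, hshift, mul_pow C, mul_pow]
  simp only [hW, div_eq_mul_inv, mul_inv]
  ring

/-! ### From the `₄φ₃` to the rational functions. -/

theorem rationalPhi_eq_sum {q : ℂ} (hq : q ≠ 0) (t a b c d : ℂ) (l m : ℕ) :
    rationalPhi q t a b c d l m = ∑ k ∈ Finset.range (l + 1), balancedCoeff q (1 / c ^ 2) l k
      * (qPoch (q * (a * t / c)) q k * qPoch (q * b * t / c) q k
        / (qPoch (q ^ (1 - (m : ℤ)) * (a * t / c)) q k * qPoch (q * t / (a * c) * q ^ m) q k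
          * qPoch (q * d / c) q k)) := by
  have hl : q ^ (-(l : ℤ)) = (q ^ l)⁻¹ := by rw [zpow_neg, zpow_natCast]
  rw [rationalPhi, basicHyp, tsum_eq_sum (s := Finset.range (l + 1))]
  · refine Finset.sum_congr rfl fun k _ => ?_
    simp only [qPochs, List.map_cons, List.map_nil, List.prod_cons, List.prod_nil, mul_one,
      List.length_cons, List.length_nil, hl, balancedCoeff]
    rw [show (1 + ((0 + 1 + 1 + 1 : ℕ) : ℤ) - ((0 + 1 + 1 + 1 + 1 : ℕ) : ℤ)) = 0 by norm_num,
      zpow_zero, mul_one, show q * a * t / c = q * (a * t / c) by ring,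
      show q ^ (1 - (m : ℤ)) * a * t / c = q ^ (1 - (m : ℤ)) * (a * t / c) by ring,
      show q ^ (m + 1) * t / (a * c) = q * t / (a * c) * q ^ m by ring,
      show q ^ l / c ^ 2 = q ^ l * (1 / c ^ 2) by ring]
    simp only [div_eq_mul_inv, mul_inv]
    ring
  · intro k hk
    have : l < k := by simpa using hk
    simp only [qPochs, List.map_cons, List.prod_cons, hl, qPoch_inv_pow_eq_zero hq this, zero_mul,
      zero_div]

/-- Trades products of length `k` whose base depends on `m` for products of length `m` whose base
depends on `k`, as the `₆φ₅` summation over `m` requires. -/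
theorem qPoch_mul_qPoch_inv {q x : ℂ} (hq : q ≠ 0) (hx : x ≠ 0) (k m : ℕ) :
    qPoch (q * x) q k * qPoch x⁻¹ q m = qPoch (q ^ (1 - (m : ℤ)) * x) q k
      * (qPoch ((q ^ k)⁻¹ * x⁻¹) q m * (q ^ k) ^ m) := by
  have hw : q ^ (1 - (m : ℤ)) = q * (q ^ m)⁻¹ := by
    rw [sub_eq_add_neg, zpow_add₀ hq, zpow_one, zpow_neg, zpow_natCast]
  rw [hw]
  induction k with
  | zero => simp [qPoch_zero]
  | succ k ih =>
    have hk : q ^ k ≠ 0 := pow_ne_zero _ hq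
    have hm : q ^ m ≠ 0 := pow_ne_zero _ hq
    have h1 := qPoch_succ ((q ^ (k + 1))⁻¹ * x⁻¹) q m
    have h2 := qPoch_succ_left ((q ^ (k + 1))⁻¹ * x⁻¹) q m
    rw [show (q ^ (k + 1))⁻¹ * x⁻¹ * q = (q ^ k)⁻¹ * x⁻¹ by rw [pow_succ]; field_simp] at h2
    rw [h1] at h2
    rw [qPoch_succ, qPoch_succ]
    have e1 : 1 - q * (q ^ m)⁻¹ * x * q ^ k
        = -(q * (q ^ m)⁻¹ * x * q ^ k) * (1 - (q ^ (k + 1))⁻¹ * x⁻¹ * q ^ m) := by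
      rw [pow_succ]; field_simp; ring
    have e2 : 1 - q * x * q ^ k = -(q * x * q ^ k) * (1 - (q ^ (k + 1))⁻¹ * x⁻¹) := by
      rw [pow_succ]; field_simp; ring
    have e3 : (q ^ (k + 1)) ^ m = (q ^ k) ^ m * q ^ m := by rw [pow_succ, mul_pow]
    rw [e1, e2, e3]
    have hmm : (q ^ m)⁻¹ * q ^ m = 1 := inv_mul_cancel₀ hm
    linear_combination (-(q * x * q ^ k) * (1 - (q ^ (k + 1))⁻¹ * x⁻¹)) * ih
      + qPoch (q * (q ^ m)⁻¹ * x) q k * (q * x * q ^ k) * (q ^ k) ^ m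
        * ((q ^ m)⁻¹ * q ^ m) * h2
      + qPoch (q * (q ^ m)⁻¹ * x) q k * (q * x * q ^ k) * (q ^ k) ^ m
        * ((1 - (q ^ (k + 1))⁻¹ * x⁻¹) * qPoch ((q ^ k)⁻¹ * x⁻¹) q m) * hmm

theorem qPoch_inv_ne_zero {q x : ℂ} (hq : q ≠ 0) (hx : x ≠ 0) {m : ℕ}
    (h : q ^ (1 - (m : ℤ)) * x ∉ qOmega q) : qPoch x⁻¹ q m ≠ 0 := by
  -- A vanishing factor forces `x = q^i` with `i < m`, so `q^{1-m} x = q^{-(m-1-i)}`.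
  refine Finset.prod_ne_zero_iff.mpr fun i hi h0 => h ⟨m - 1 - i, ?_⟩
  have hi := Finset.mem_range.mp hi
  have hxi : x = q ^ (i : ℤ) := by
    rw [zpow_natCast]
    field_simp at h0
    linear_combination h0
  rw [hxi, ← zpow_add₀ hq]
  congr 1
  omega

theorem rationalPhi_mul_eq_rationalSum {q t a b c d : ℂ} (hq : q ≠ 0) (ht : t ≠ 0) (ha : a ≠ 0)
    (hc : c ≠ 0) (hv : q * t / (a * c) ∉ qOmega q) {m : ℕ}
    (hm : q ^ (1 - (m : ℤ)) * a * t / c ∉ qOmega q) (l : ℕ) :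
    rationalPhi q t a b c d l m * (qPoch (c / (a * t)) q m / qPoch (q * t / (a * c)) q m)
      = rationalSum q (1 / c ^ 2) (q * b * t / c) (q * t / (a * c)) (q * d / c) (c / (a * t))
        l m := by
  rw [rationalPhi_eq_sum hq, rationalSum, Finset.sum_mul]
  refine Finset.sum_congr rfl fun k _ => ?_
  have hx : a * t / c ≠ 0 := div_ne_zero (mul_ne_zero ha ht) hc
  have hm' : q ^ (1 - (m : ℤ)) * (a * t / c) ∉ qOmega q := by
    rwa [show q ^ (1 - (m : ℤ)) * (a * t / c) = q ^ (1 - (m : ℤ)) * a * t / c by ring]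
  have h := qPoch_mul_qPoch_inv hq hx k m
  rw [inv_div] at h
  have hw := qPoch_ne_zero hm' k
  have hv1 := qPoch_ne_zero hv k
  have hv2 := qPoch_ne_zero hv m
  have hv3 := qPoch_ne_zero (mul_pow_notMem_qOmega hq hv m) k
  have hv4 := qPoch_ne_zero (mul_pow_notMem_qOmega hq hv k) m
  have hvv : qPoch (q * t / (a * c)) q m * qPoch (q * t / (a * c) * q ^ m) q k
      = qPoch (q * t / (a * c)) q k * qPoch (q * t / (a * c) * q ^ k) q m := by
    rw [← qPoch_add, ← qPoch_add, add_comm]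
  generalize q * t / (a * c) = v at *
  generalize a * t / c = x at *
  generalize q ^ (1 - (m : ℤ)) * x = w at *
  have key : qPoch (q * x) q k * qPoch (c / (a * t)) q m
      / (qPoch w q k * (qPoch v q m * qPoch (v * q ^ m) q k))
      = qPoch ((q ^ k)⁻¹ * (c / (a * t))) q m * (q ^ k) ^ m
        / (qPoch v q k * qPoch (v * q ^ k) q m) := by
    rw [h, hvv, mul_div_mul_left _ _ hw]
  have e := congrArg (fun z => balancedCoeff q (1 / c ^ 2) l k * (qPoch (q * b * t / c) q k
    / qPoch (q * d / c) q k) * z) key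
  simp only [div_eq_mul_inv, mul_inv] at e ⊢
  linear_combination e

/-! ### Specialisation of the parameters and the two relations. -/

theorem bioConst_swap {a b c d : ℂ} (ha : a ≠ 0) (hc : c ≠ 0)
    (h : a * b = c * d) (q t : ℂ) : bioConst q t c d a b = bioConst q t a b c d := by
  have e : ∀ s, q * d * s / a = q * b * s / c := fun s => by
    field_simp; linear_combination -q * s * h
  simp only [bioConst, e, mul_comm c a, qPochsInf, List.map_cons, List.map_nil, List.prod_cons,
    List.prod_nil]
  ring

theorem qPoch_one_div_sq_ne_zero {q c : ℂ} (hc : c ≠ 0) {l : ℕ} (hl : ∀ k < l, c ^ 2 ≠ q ^ k) :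
    qPoch (1 / c ^ 2) q l ≠ 0 := by
  refine Finset.prod_ne_zero_iff.mpr fun k hk h0 => hl k (Finset.mem_range.mp hk) ?_
  field_simp at h0
  linear_combination h0

theorem hasSum_rationalSum_biorthogonal {q t a b c d : ℂ} (hq : q ≠ 0) (hq1 : ‖q‖ < 1)
    (ht : t ≠ 0) (ha : a ≠ 0) (hb : b ≠ 0) (hc : c ≠ 0) (hd : d ≠ 0) (habcd : a * b = c * d)
    (hv : q * t / (a * c) ∉ qOmega q) (hv' : q * t⁻¹ / (a * c) ∉ qOmega q)
    (hz : ‖q * d‖ < ‖c‖) (hba : q * b / a ∉ qOmega q) (ha1 : a ^ 2 ≠ 1) (l l' : ℕ)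
    (hl : ∀ k < l, c ^ 2 ≠ q ^ k) (hl2 : c ^ 2 ≠ q ^ (2 * l)) :
    HasSum (fun m : ℕ => (1 - q ^ (2 * m) / a ^ 2) / (1 - 1 / a ^ 2)
        * (qPoch (1 / a ^ 2) q m * qPoch (1 / (a * b)) q m / (qPoch q q m * qPoch (q * b / a) q m))
        * (q * d / c) ^ m
        * rationalSum q (1 / c ^ 2) (q * b * t / c) (q * t / (a * c)) (q * d / c) (c / (a * t)) l m
        * rationalSum q (1 / c ^ 2) (q * b * t⁻¹ / c) (q * t⁻¹ / (a * c)) (q * d / c)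
          (c / (a * t⁻¹)) l' m)
      (bioConst q t a b c d * (q * d / c) ^ l
            * ((1 - 1 / c ^ 2) / (1 - q ^ (2 * l) / c ^ 2))
            * (qPoch q q l * qPoch (1 / (c * d)) q l / (qPoch (1 / c ^ 2) q l * qPoch (q * d / c) q l))
            * (if l = l' then 1 else 0)) := by
  have hbeq : b = c * d / a := by field_simp; linear_combination habcd
  have e1 : 1 / a ^ 2 * q / (1 / (a * b)) = q * b / a := by field_simp
  have e2 : 1 / a ^ 2 * q / (c / (a * t)) = q * t / (a * c) := by field_simp
  have e3 : 1 / a ^ 2 * q / (c / (a * t⁻¹)) = q * t⁻¹ / (a * c) := by field_simp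
  have e4 : 1 / a ^ 2 * q / (1 / (a * b) * (c / (a * t))) = q * b * t / c := by field_simp
  have e5 : 1 / a ^ 2 * q / (1 / (a * b) * (c / (a * t⁻¹))) = q * b * t⁻¹ / c := by field_simp
  have e6 : 1 / a ^ 2 / (c / (a * t) * (c / (a * t⁻¹))) = 1 / c ^ 2 := by field_simp
  have e7 : 1 / a ^ 2 * q / (1 / (a * b) * (c / (a * t)) * (c / (a * t⁻¹))) = q * d / c := by
    rw [hbeq]; field_simp
  have hz' : ‖q * d / c‖ < 1 := by
    rw [norm_div]; exact (div_lt_one (norm_pos_iff.mpr hc)).mpr hz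
  -- With this choice `y = 1/c²` and `C = qd/c`, so the convergence condition is `|qd| < |c|`.
  have h := hasSum_rationalSum_mul (A := 1 / a ^ 2) (B := 1 / (a * b)) (X := c / (a * t))
    (X' := c / (a * t⁻¹)) hq hq1 (fun h => ha1 (by field_simp at h; exact h.symm)) (by simp [ha])
    (by simp [ha, hb]) (by simp [ha, hc, ht]) (by simp [ha, hc, ht]) (by rwa [e1]) (by rwa [e2]) (by rwa [e3])
    (by rwa [e7]) l l'
  rw [e1, e2, e3, e4, e5, e6, e7] at h
  have htr : ∀ {f g : ℕ → ℂ} {r s : ℂ}, HasSum f r → (∀ m, g m = f m) → r = s → HasSum g s :=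
    fun h e e' => e' ▸ (funext e) ▸ h
  refine htr h (fun m => by rw [one_div_mul_eq_div]) ?_
  by_cases hll : l = l'
  swap
  · simp [hll]
  rw [if_pos hll, if_pos hll, mul_one]
  have hy := qPoch_one_div_sq_ne_zero hc hl
  have hy2 : 1 - q ^ (2 * l) / c ^ 2 ≠ 0 := fun h0 => hl2 (by
    field_simp at h0; linear_combination h0)
  -- Both sides equal `(1/c²;q)_∞`, split after `2l + 1` factors and after one.
  have hinf : qPoch (1 / c ^ 2) q l * (qPoch (q ^ l * (1 / c ^ 2)) q l
      * qPochInf (q * (1 / c ^ 2) * q ^ (l + l)) q) * (1 - q ^ (2 * l) / c ^ 2)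
      = (1 - 1 / c ^ 2) * qPochInf (q / c ^ 2) q := by
    have h1 := qPochInf_eq_qPoch_mul hq1 (1 / c ^ 2) 1
    have h2 := qPochInf_eq_qPoch_mul hq1 (1 / c ^ 2) (l + l + 1)
    rw [qPoch_succ, qPoch_add] at h2
    rw [qPoch_succ, qPoch_zero] at h1
    rw [show 1 / c ^ 2 * q ^ (l + l + 1) = q * (1 / c ^ 2) * q ^ (l + l) by ring,
      mul_comm (1 / c ^ 2) (q ^ l), show 1 / c ^ 2 * q ^ (l + l) = q ^ (2 * l) / c ^ 2 by ring] at h2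
    rw [pow_zero, pow_one, mul_one, one_mul, one_div_mul_eq_div] at h1
    rw [← h1, h2]
    ring
  have hinf' : qPoch (q ^ l * (1 / c ^ 2)) q l * qPochInf (q * (1 / c ^ 2) * q ^ (l + l)) q
      = (1 - 1 / c ^ 2) / (1 - q ^ (2 * l) / c ^ 2) * qPochInf (q / c ^ 2) q
        * (qPoch (1 / c ^ 2) q l)⁻¹ := by
    rw [eq_mul_inv_iff_mul_eq₀ hy, div_mul_eq_mul_div, eq_div_iff hy2]
    linear_combination hinf
  rw [one_div_mul_eq_div, habcd]
  simp only [bioConst, qPochsInf, List.map_cons, List.map_nil, List.prod_cons, List.prod_nil]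
  linear_combination (qPochInf (q / a ^ 2) q * qPochInf (q * b * t / c) q
    * qPochInf (q * b * t⁻¹ / c) q / (qPochInf (q * b / a) q * qPochInf (q * t / (a * c)) q
      * qPochInf (q * t⁻¹ / (a * c)) q * qPochInf (q * d / c) q)
    * (qPoch q q l * qPoch (1 / (c * d)) q l / qPoch (q * d / c) q l * (q * d / c) ^ l)) * hinf'

theorem hasSum_over_argument {q t a b c d : ℂ} (hq : q ≠ 0) (hq1 : ‖q‖ < 1)
    (ht : t ≠ 0) (ha : a ≠ 0) (hb : b ≠ 0) (hc : c ≠ 0) (hd : d ≠ 0) (habcd : a * b = c * d)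
    (hv : q * t / (a * c) ∉ qOmega q) (hv' : q * t⁻¹ / (a * c) ∉ qOmega q)
    (hz : ‖q * d‖ < ‖c‖) (hba : q * b / a ∉ qOmega q) (ha1 : a ^ 2 ≠ 1)
    (hm : ∀ m : ℕ, q ^ (1 - (m : ℤ)) * a * t / c ∉ qOmega q)
    (hm' : ∀ m : ℕ, q ^ (1 - (m : ℤ)) * a * t⁻¹ / c ∉ qOmega q) (l l' : ℕ)
    (hl : ∀ k < l, c ^ 2 ≠ q ^ k) (hl2 : c ^ 2 ≠ q ^ (2 * l)) :
    HasSum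
      (fun m : ℕ =>
        (1 - q ^ (2 * m) / a ^ 2) / (1 - 1 / a ^ 2)
          * (qPochs [1 / a ^ 2, 1 / (a * b), c * t / a, c * t⁻¹ / a] q m
              / qPochs [q, q * b / a, q * t / (a * c), q * t⁻¹ / (a * c)] q m)
          * (q * d / c) ^ m
          * rationalPhi q t a b c d l m
          * rationalPhi q t⁻¹ a b c d l' m)
      (bioConst q t a b c d * (q * d / c) ^ l
        * ((1 - 1 / c ^ 2) / (1 - q ^ (2 * l) / c ^ 2))
        * (qPochs [q, 1 / (c * d)] q l / qPochs [1 / c ^ 2, q * d / c] q l)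
        * (if l = l' then 1 else 0)) := by
  have h := hasSum_rationalSum_biorthogonal hq hq1 ht ha hb hc hd habcd hv hv' hz hba ha1 l l' hl
    hl2
  have htr : ∀ {f g : ℕ → ℂ} {r s : ℂ}, HasSum f r → (∀ m, g m = f m) → r = s → HasSum g s :=
    fun h e e' => e' ▸ (funext e) ▸ h
  refine htr h (fun m => ?_) ?_
  · rw [← rationalPhi_mul_eq_rationalSum hq ht ha hc hv (hm m),
      ← rationalPhi_mul_eq_rationalSum hq (inv_ne_zero ht) ha hc hv' (hm' m),
      show c / (a * t) = c * t⁻¹ / a by field_simp, show c / (a * t⁻¹) = c * t / a by field_simp]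
    simp only [qPochs, List.map_cons, List.map_nil, List.prod_cons, List.prod_nil, div_eq_mul_inv,
      mul_inv, mul_one, one_mul]
    ring
  · simp only [qPochs, List.map_cons, List.map_nil, List.prod_cons, List.prod_nil, mul_one]

/-- `rationalPhi` as a rational function of degree `m` in the variable `l`. -/
theorem rationalPhi_duality {q t a b c d : ℂ} (hq : q ≠ 0) (hq1 : ‖q‖ < 1) (ht : t ≠ 0)
    (ha : a ≠ 0) (hb : b ≠ 0) (hc : c ≠ 0) (hd : d ≠ 0) (habcd : a * b = c * d)
    (hv : q * t / (a * c) ∉ qOmega q) (hba : q * b / a ∉ qOmega q) (hdc : q * d / c ∉ qOmega q)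
    (hab : 1 / (a * b) ∉ qOmega q) {m : ℕ} (hm : q ^ (1 - (m : ℤ)) * a * t / c ∉ qOmega q)
    (l : ℕ) :
    rationalPhi q t a b c d l m
      = qPoch (q * b / a) q m * qPoch (q * t / (a * c)) q m
          / (qPoch (1 / (a * b)) q m * qPoch (c * t⁻¹ / a) q m * (q * b * t / c) ^ m)
        * (qPoch (1 / (a * b)) q l / qPoch (q * d / c) q l * (q * b * t / c) ^ l
          * rationalSum q (1 / a ^ 2) (q * d * t / a) (q * t / (c * a)) (q * b / a)
            (a / (c * t)) m l) := by
  have hbeq : b = c * d / a := by field_simp; linear_combination habcd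
  have h1 := rationalPhi_mul_eq_rationalSum (b := b) (d := d) hq ht ha hc hv hm l
  have hu : q * b * t / c ≠ 0 := by simp [hq, hb, ht, hc]
  have h2 := rationalSum_duality (y := 1 / c ^ 2) (A := 1 / a ^ 2) (u := q * b * t / c)
    (v := q * t / (a * c)) (C := q * d / c) (C' := q * b / a) hq hq1 hu
    (by simp [hq, hd, hc]) (by simp [hq, hb, ha]) hv hdc hba
    (by rw [hbeq]; field_simp) (by field_simp) l m
  rw [show q * (1 / a ^ 2) / (q * b / a) = 1 / (a * b) by field_simp,
    show q * b / a / (q * b * t / c) = c / (a * t) by field_simp,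
    show q * (1 / c ^ 2) / (q * d / c) = 1 / (a * b) by rw [habcd]; field_simp,
    show q * d / c / (q * b * t / c) = a / (c * t) by rw [hbeq]; field_simp, ← h1] at h2
  rw [show q * d * t / a = q * b * t / c by rw [hbeq]; field_simp, mul_comm c a, ← h2,
    show c / (a * t) = c * t⁻¹ / a by field_simp]
  have n1 := qPoch_ne_zero hba m
  have n2 := qPoch_ne_zero hv m
  have n3 := qPoch_ne_zero hab m
  have n4 : qPoch (c * t⁻¹ / a) q m ≠ 0 := by
    have hm' : q ^ (1 - (m : ℤ)) * (a * t / c) ∉ qOmega q := by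
      rwa [show q ^ (1 - (m : ℤ)) * (a * t / c) = q ^ (1 - (m : ℤ)) * a * t / c by ring]
    have := qPoch_inv_ne_zero hq (by simp [ha, ht, hc]) hm'
    rwa [inv_div, show c / (a * t) = c * t⁻¹ / a by field_simp] at this
  have n5 := pow_ne_zero m hu
  generalize (q * b * t / c) ^ m = U at *
  generalize qPoch (c * t⁻¹ / a) q m = X at *
  generalize qPoch (1 / (a * b)) q m = B at *
  generalize qPoch (q * b / a) q m = C' at *
  generalize qPoch (q * t / (a * c)) q m = V at *
  field_simp

theorem hasSum_over_degree {q t a b c d : ℂ} (hq : q ≠ 0) (hq1 : ‖q‖ < 1)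
    (ht : t ≠ 0) (ha : a ≠ 0) (hb : b ≠ 0) (hc : c ≠ 0) (hd : d ≠ 0) (habcd : a * b = c * d)
    (hv : q * t / (a * c) ∉ qOmega q) (hv' : q * t⁻¹ / (a * c) ∉ qOmega q)
    (hz : ‖q * b‖ < ‖a‖) (hab : 1 / (a * b) ∉ qOmega q) (hdc : q * d / c ∉ qOmega q)
    (hc1 : c ^ 2 ≠ 1) (m m' : ℕ)
    (hm : q ^ (1 - (m : ℤ)) * a * t / c ∉ qOmega q)
    (hm' : q ^ (1 - (m' : ℤ)) * a * t⁻¹ / c ∉ qOmega q)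
    (hma : ∀ k < m, a ^ 2 ≠ q ^ k) (hma2 : a ^ 2 ≠ q ^ (2 * m)) :
    HasSum
      (fun l : ℕ =>
        (1 - q ^ (2 * l) / c ^ 2) / (1 - 1 / c ^ 2)
          * (qPochs [q * d / c, 1 / c ^ 2] q l / qPochs [q, 1 / (a * b)] q l)
          * (c / (q * d)) ^ l
          * rationalPhi q t a b c d l m
          * rationalPhi q t⁻¹ a b c d l m')
      (bioConst q t a b c d * (c / (q * d)) ^ m
        * ((1 - 1 / a ^ 2) / (1 - q ^ (2 * m) / a ^ 2))
        * (qPochs [q, q * b / a, q * t / (a * c), q * t⁻¹ / (a * c)] q m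
            / qPochs [1 / a ^ 2, 1 / (a * b), c * t / a, c * t⁻¹ / a] q m)
        * (if m = m' then 1 else 0)) := by
  have hba : q * b / a ∉ qOmega q := notMem_qOmega_of_norm_lt_one hq hq1
    (by rw [norm_div]; exact (div_lt_one (norm_pos_iff.mpr ha)).mpr hz)
  have hbeq : b = c * d / a := by field_simp; linear_combination habcd
  -- Relation (2) with `(a,b)` and `(c,d)` exchanged: `m`, `m'` are now the degrees and `l` the
  -- argument.
  have h := hasSum_rationalSum_biorthogonal hq hq1 ht hc hd ha hb habcd.symm
    (by rwa [mul_comm c a]) (by rwa [mul_comm c a]) hz hdc hc1 m m' hma hma2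
  rw [bioConst_swap ha hc habcd] at h
  set P : ℂ → ℕ → ℂ := fun s n => qPoch (q * b / a) q n * qPoch (q * s / (a * c)) q n
    / (qPoch (1 / (a * b)) q n * qPoch (c * s⁻¹ / a) q n * (q * b * s / c) ^ n) with hP
  have htr : ∀ {f g : ℕ → ℂ} {r s : ℂ}, HasSum f r → (∀ m, g m = f m) → r = s → HasSum g s :=
    fun h e e' => e' ▸ (funext e) ▸ h
  have hpow : ∀ n : ℕ, (c / (q * d)) ^ n * (q * b * t / c) ^ n * (q * b * t⁻¹ / c) ^ n
      = (q * b / a) ^ n := fun n => by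
    rw [← mul_pow, ← mul_pow]
    congr 1
    rw [hbeq]
    field_simp
  refine htr (h.mul_left (P t m * P t⁻¹ m')) (fun l => ?_) ?_
  · have d1 : rationalPhi q t a b c d l m = P t m * _ :=
      rationalPhi_duality hq hq1 ht ha hb hc hd habcd hv hba hdc hab hm l
    have d2 : rationalPhi q t⁻¹ a b c d l m' = P t⁻¹ m' * _ :=
      rationalPhi_duality hq hq1 (inv_ne_zero ht) ha hb hc hd habcd hv' hba hdc hab hm' l
    have n1 := qPoch_ne_zero hab l
    have n2 := qPoch_ne_zero hdc l
    -- Duality contributes `(1/(ab))_l/(qd/c)_l` once for `t` and once for `t⁻¹`; together they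
    -- invert the corresponding factor of the weight, giving the weight of the exchanged relation.
    have hcan : qPoch (q * d / c) q l / qPoch (1 / (a * b)) q l
        * (qPoch (1 / (a * b)) q l / qPoch (q * d / c) q l)
        * (qPoch (1 / (a * b)) q l / qPoch (q * d / c) q l)
        = qPoch (1 / (a * b)) q l / qPoch (q * d / c) q l := by
      generalize qPoch (1 / (a * b)) q l = B at *
      field_simp
    rw [d1, d2, ← habcd, ← hpow]
    simp only [qPochs, List.map_cons, List.map_nil, List.prod_cons, List.prod_nil, mul_one]
    generalize rationalSum q (1 / a ^ 2) (q * d * t / a) _ _ _ m l = S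
    generalize rationalSum q (1 / a ^ 2) (q * d * t⁻¹ / a) _ _ _ m' l = S'
    linear_combination (P t m * P t⁻¹ m' * ((1 - q ^ (2 * l) / c ^ 2) / (1 - 1 / c ^ 2))
      * (qPoch (1 / c ^ 2) q l / qPoch q q l) * ((c / (q * d)) ^ l * (q * b * t / c) ^ l
        * (q * b * t⁻¹ / c) ^ l) * S * S') * hcan
  · by_cases hmm : m = m'
    swap
    · simp [hmm]
    subst hmm
    rw [← hpow]
    simp only [hP, qPochs, List.map_cons, List.map_nil, List.prod_cons, List.prod_nil, mul_one,
      inv_inv]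
    have n1 := qPoch_ne_zero hab m
    have n2 := qPoch_ne_zero hba m
    have n3 : (q * b * t / c) ^ m ≠ 0 := pow_ne_zero _ (by simp [hq, hb, ht, hc])
    have n4 : (q * b * t⁻¹ / c) ^ m ≠ 0 := pow_ne_zero _ (by simp [hq, hb, ht, hc])
    generalize (q * b * t / c) ^ m = U at *
    generalize (q * b * t⁻¹ / c) ^ m = U' at *
    generalize qPoch (1 / (a * b)) q m = B at *
    generalize qPoch (q * b / a) q m = C' at *
    have hcan : C' * B⁻¹ * U⁻¹ * (C' * B⁻¹ * U'⁻¹) * (U * U') * (B * C'⁻¹) = C' * B⁻¹ := by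
      field_simp
    simp only [div_eq_mul_inv, mul_inv, if_true, mul_one]
    linear_combination (bioConst q t a b c d * (c * (q⁻¹ * d⁻¹)) ^ m
      * ((1 - 1 * (a ^ 2)⁻¹) * (1 - q ^ (2 * m) * (a ^ 2)⁻¹)⁻¹)
      * (qPoch q q m * qPoch (q * t * (a⁻¹ * c⁻¹)) q m * qPoch (q * t⁻¹ * (a⁻¹ * c⁻¹)) q m)
      * ((qPoch (1 * (a ^ 2)⁻¹) q m)⁻¹ * (qPoch (c * t * a⁻¹) q m)⁻¹
        * (qPoch (c * t⁻¹ * a⁻¹) q m)⁻¹)) * hcan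

theorem theorem7p1 (q : ℝ) (hq0 : 0 < q) (hq1 : q < 1) (t a b c d : ℂ)
    (ht : t ≠ 0) (ha : a ≠ 0) (hb : b ≠ 0) (hc : c ≠ 0) (hd : d ≠ 0)
    (habcd : a * b = c * d)
    (hden₁ : q * t / (a * c) ∉ qOmega q) (hden₂ : q * t⁻¹ / (a * c) ∉ qOmega q) :
    -- first relation, summed over `l`
    (‖q * b‖ < ‖a‖ →
      1 / (a * b) ∉ qOmega q → q * d / c ∉ qOmega q → c ^ 2 ≠ 1 →
      ∀ m m' : ℕ,
        (q : ℂ) ^ (1 - (m : ℤ)) * a * t / c ∉ qOmega q →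
        (q : ℂ) ^ (1 - (m' : ℤ)) * a * t⁻¹ / c ∉ qOmega q →
        (∀ k < m, a ^ 2 ≠ q ^ k) → a ^ 2 ≠ q ^ (2 * m) →
        HasSum
          (fun l : ℕ =>
            (1 - q ^ (2 * l) / c ^ 2) / (1 - 1 / c ^ 2)
              * (qPochs [q * d / c, 1 / c ^ 2] q l / qPochs [(q : ℂ), 1 / (a * b)] q l)
              * (c / (q * d)) ^ l
              * rationalPhi q t a b c d l m
              * rationalPhi q t⁻¹ a b c d l m')
          (bioConst q t a b c d * (c / (q * d)) ^ m
            * ((1 - 1 / a ^ 2) / (1 - q ^ (2 * m) / a ^ 2))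
            * (qPochs [(q : ℂ), q * b / a, q * t / (a * c), q * t⁻¹ / (a * c)] q m
                / qPochs [1 / a ^ 2, 1 / (a * b), c * t / a, c * t⁻¹ / a] q m)
            * (if m = m' then 1 else 0)))
    ∧
    -- second relation, summed over `m`
    (‖q * d‖ < ‖c‖ →
      q * b / a ∉ qOmega q → a ^ 2 ≠ 1 →
      (∀ m : ℕ, (q : ℂ) ^ (1 - (m : ℤ)) * a * t / c ∉ qOmega q) →
      (∀ m : ℕ, (q : ℂ) ^ (1 - (m : ℤ)) * a * t⁻¹ / c ∉ qOmega q) →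
      ∀ l l' : ℕ,
        (∀ k < l, c ^ 2 ≠ q ^ k) → c ^ 2 ≠ q ^ (2 * l) →
        HasSum
          (fun m : ℕ =>
            (1 - q ^ (2 * m) / a ^ 2) / (1 - 1 / a ^ 2)
              * (qPochs [1 / a ^ 2, 1 / (a * b), c * t / a, c * t⁻¹ / a] q m
                  / qPochs [(q : ℂ), q * b / a, q * t / (a * c), q * t⁻¹ / (a * c)] q m)
              * (q * d / c) ^ m
              * rationalPhi q t a b c d l m
              * rationalPhi q t⁻¹ a b c d l' m)
          (bioConst q t a b c d * (q * d / c) ^ l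
            * ((1 - 1 / c ^ 2) / (1 - q ^ (2 * l) / c ^ 2))
            * (qPochs [(q : ℂ), 1 / (c * d)] q l / qPochs [1 / c ^ 2, q * d / c] q l)
            * (if l = l' then 1 else 0))) := by
  have hq : (q : ℂ) ≠ 0 := Complex.ofReal_ne_zero.mpr hq0.ne'
  have hq1' : ‖(q : ℂ)‖ < 1 := by rwa [Complex.norm_real, Real.norm_of_nonneg hq0.le]
  exact ⟨fun hz hab hdc hc1 m m' hm hm' hma hma2 =>
      hasSum_over_degree hq hq1' ht ha hb hc hd habcd hden₁ hden₂ hz hab hdc hc1 m m' hm hm' hma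
        hma2,
    fun hz hba ha1 hm hm' l l' hl hl2 =>
      hasSum_over_argument hq hq1' ht ha hb hc hd habcd hden₁ hden₂ hz hba ha1 hm hm' l l' hl hl2⟩
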